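/- Let $d\ge 1$, $n_1,\dots,n_d\ge 1$ and $r\ge 0$ be integers, and give $\mathbb R^{n_1\times\cdots\times n_d}$ the Frobenius inner product and $(\mathbb R^{n_1\times\cdots\times n_d})^{r}$ the product Euclidean inner product. Let $\mathcal S$ be the set of tensors of rank one, $\Phi_r:\mathcal S^{\times r}\to\mathbb R^{n_1\times\cdots\times n_d}$ the addition map $(\mathcal A_1,\dots,\mathcal A_r)\mapsto \mathcal A_1+\cdots+\mathcal A_r$, $\sigma_r$ the set of tensors of rank at most $r$, and $\overline{\sigma_r}$ its real Zariski closure. A tensor is $r$-identifiable if it has rank $r$ and its decomposition into $r$ rank-one tensors is unique up to order. Assume that $\mathcal S$ is generically $r$-identifiable: there is a proper Zariski closed subset $Z\subsetneq\overline{\sigma_r}$ such that all elements of $\sigma_r\setminus Z$ are $r$-identifiable. For $\mathfrak a=(\mathcal A_1,\dots,\mathcal A_r)\in\mathcal S^{\times r}$ with $\mathcal A=\Phi_r(\mathfrak a)$ let $$\kappa(\mathcal A_1,\dots,\mathcal A_r)=\lim_{\epsilon\to0}\ \sup_{\substack{\mathcal B\text{ of rank }r,\\ 0<\|\mathcal A-\mathcal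 B\|<\epsilon}}\frac{\|\Phi_{\mathfrak a}^{-1}(\mathcal A)-\Phi_{\mathfrak a}^{-1}(\mathcal B)\|}{\|\mathcal A-\mathcal B\|},$$ where $\Phi_{\mathfrak a}^{-1}$ is a continuous local inverse of $\Phi_r$ defined on the image of a neighbourhood of $\mathfrak a$ in $\mathcal S^{\times r}$, $\Phi_{\mathfrak a}^{-1}(\mathcal A)=\mathfrak a$, and $\mathcal B$ runs through its domain; $\kappa=\infty$ if there is no local inverse. Vectors $p_1,\dots,p_r\in\mathbb R^N$ are in general linear position if any $\min\{r,N\}$ of them are linearly independent. Let $\mathcal M\subset\mathcal S^{\times r}$ be the set of all $\mathfrak a=(\mathcal A_1,\dots,\mathcal A_r)$, $\mathcal A_i=a_i^1\otimes\cdots\otimes a_i^d$, such that (i) $\Phi_r(\mathfrak a)$ is a smooth point of $\overline{\sigma_r}$; (ii) $\Phi_r(\mathfrak a)$ is $r$-identifiable; (iii) $\kappa(\mathfrak a)<\infty$; (iv) for every nonempty $\{h_1<\dots<h_s\}\subset\{1,\dots,d\}$ the vectors $a_i^{h_1}\otimes\cdots\otimes a_i^{h_s}$, $i=1,\dots,r$,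 are in general linear position; (v) the $(1,\dots,1)$-entry of every $\mathcal A_i$ is nonzero. Let $\mathcal N=\Phi_r(\mathcal M)$, let $\widehat{\mathcal M}=\mathcal M/\mathfrak S_r$ be the quotient by the symmetric group that permutes the entries, with the quotient topology, let $\widehat\pi:\mathcal M\to\widehat{\mathcal M}$ be the projection, and let $\tau:\mathcal N\to\widehat{\mathcal M}$, $\mathcal A_1+\cdots+\mathcal A_r\mapsto\{\mathcal A_1,\dots,\mathcal A_r\}$ be the tensor decomposition map. Then $\mathcal M$ and $\mathcal N$ are embedded smooth submanifolds of their ambient Euclidean spaces, of dimension $r(1+\sum_k(n_k-1))$, $\widehat{\mathcal M}$ (Hausdorff and second countable) is a smooth manifold of the same dimension such that $\widehat\pi$ is a local diffeomorphism, and $\tau$ is smooth. If $\mathcal M$ and $\mathcal N$ carry the Riemannian metrics inherited from their ambient spaces, then there is a unique Riemannian metric on $\widehat{\mathcal M}$ (the one induced by $\widehat\pi$) for which 1. $\widehat\pi$ is a local isometry; and with this metric 2. for all $(\mathcal A_1,\dots,\mathcal A_r)\in\mathcal M$ with sum $\mathcal A\in\mathcal N$, $\kappa(\mathcal A_1,\dots,\mathcal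 A_r)=\kappa[\tau](\mathcal A)$, where $\kappa[\tau](\mathcal A)=\sup_{0\ne t\in T_{\mathcal A}\mathcal N}\|(d_{\mathcal A}\tau)(t)\|/\|t\|$ in the Riemannian norms (the supremum of the empty set being $0$); 3. for all $(\mathcal A_1,\dots,\mathcal A_r),(\mathcal B_1,\dots,\mathcal B_r)\in\mathcal M$, $$\mathrm{dist}_{\widehat{\mathcal M}}(\{\mathcal A_1,\dots,\mathcal A_r\},\{\mathcal B_1,\dots,\mathcal B_r\})=\min_{\pi\in\mathfrak S_r}\mathrm{dist}_{\mathcal M}\bigl((\mathcal A_1,\dots,\mathcal A_r),\pi(\mathcal B_1,\dots,\mathcal B_r)\bigr),$$ where $\mathrm{dist}$ is the Riemannian distance, i.e. the infimum of the lengths of $C^1$ curves joining two points ($\infty$ if there are none). -/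

import Mathlib

open scoped Manifold ContDiff

noncomputable section

/-! ### Riemannian geometry -/

section Riemannian

/-- Smooth Riemannian metrics on a smooth `m`-dimensional manifold `X` without boundary. -/
abbrev RMetric (m : ℕ) (X : Type) [TopologicalSpace X]
    [ChartedSpace (EuclideanSpace ℝ (Fin m)) X] [IsManifold (𝓡 m) ∞ X] : Type :=
  Bundle.ContMDiffRiemannianMetric (𝓡 m) ∞ (EuclideanSpace ℝ (Fin m))
    (fun x : X => TangentSpace (𝓡 m) x)

namespace RMetric

variable {m p : ℕ} {X Y : Type}
  [TopologicalSpace X] [ChartedSpace (EuclideanSpace ℝ (Fin m)) X] [IsManifold (𝓡 m) ∞ X]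
  [TopologicalSpace Y] [ChartedSpace (EuclideanSpace ℝ (Fin p)) Y] [IsManifold (𝓡 p) ∞ Y]

/-- The norm `√ g_x(v, v)` of a tangent vector. -/
def tnorm (g : RMetric m X) (x : X) (v : TangentSpace (𝓡 m) x) : ℝ :=
  Real.sqrt (g.inner x v v)

open scoped Bundle in
/-- The Riemannian distance: the infimum of the lengths of the `C^1` curves from `x` to `y`
(it is `⊤` when `x` and `y` cannot be joined). -/
def dist (g : RMetric m X) (x y : X) : ENNReal :=
  letI : Bundle.RiemannianBundle (fun x : X => TangentSpace (𝓡 m) x) := ⟨g.toRiemannianMetric⟩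
  Manifold.riemannianEDist (𝓡 m) x y

/-- `ι : X → F` exhibits `X` as an embedded submanifold of the Euclidean space `F`, and `g` is the
metric that `X` inherits from `F`. (The differential of `ι` is injective, since `g` is positive
definite; so `ι` is an immersion.) -/
structure IsInherited {F : Type} [NormedAddCommGroup F] [InnerProductSpace ℝ F]
    (g : RMetric m X) (ι : X → F) : Prop where
  contMDiff : ContMDiff (𝓡 m) 𝓘(ℝ, F) ∞ ι
  isEmbedding : Topology.IsEmbedding ι
  inner_eq : ∀ (x : X) (v w : TangentSpace (𝓡 m) x),
    g.inner x v w =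
      @inner ℝ F _ (mfderiv (𝓡 m) 𝓘(ℝ, F) ι x v) (mfderiv (𝓡 m) 𝓘(ℝ, F) ι x w)

/-- Local isometries of Riemannian manifolds: local diffeomorphisms whose differentials
preserve the Riemannian metrics. -/
structure IsLocalIsometry (g : RMetric m X) (h : RMetric p Y) (f : X → Y) : Prop where
  isLocalDiffeomorph : IsLocalDiffeomorph (𝓡 m) (𝓡 p) ∞ f
  inner_eq : ∀ (x : X) (v w : TangentSpace (𝓡 m) x),
    h.inner (f x) (mfderiv (𝓡 m) (𝓡 p) f x v) (mfderiv (𝓡 m) (𝓡 p) f x w) = g.inner x v w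

/-- The condition number at `x` of a smooth map `f` between Riemannian manifolds: the maximum over
nonzero tangent vectors `v` at `x` of `‖(d_x f)(v)‖ / ‖v‖`. -/
def conditionNumber (g : RMetric m X) (h : RMetric p Y) (f : X → Y) (x : X) : ENNReal :=
  ⨆ (v : TangentSpace (𝓡 m) x) (_ : v ≠ 0),
    ENNReal.ofReal (h.tnorm (f x) (mfderiv (𝓡 m) (𝓡 p) f x v) / g.tnorm x v)

end RMetric

end Riemannian

/-! ### Tensors -/

namespace CPD

variable {d : ℕ} (n : Fin d → ℕ) (r : ℕ)

/-- Real `n₁ × ⋯ × n_d` arrays, with the Frobenius inner product. -/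
abbrev Tensor : Type := EuclideanSpace ℝ (∀ k, Fin (n k))

/-- `r`-tuples of tensors, with the product Euclidean structure. -/
abbrev Tuple : Type := PiLp 2 (fun _ : Fin r => Tensor n)

variable {n r}

/-- The elementary tensor `f 1 ⊗ ⋯ ⊗ f d`. -/
def elementary (f : ∀ k, Fin (n k) → ℝ) : Tensor n :=
  WithLp.toLp 2 (fun idx => ∏ k, f k (idx k))

variable (n) in
/-- The Segre manifold `S`: the tensors of rank one. -/
def segre : Set (Tensor n) := {A | A ≠ 0 ∧ ∃ f, A = elementary f}

variable (n r) in
/-- `S × ⋯ × S` (`r` factors). -/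
def segreTuples : Set (Tuple n r) := {a | ∀ i, a i ∈ segre n}

/-- The addition map `Φ_r`. -/
def addMap (a : Tuple n r) : Tensor n := ∑ i, a i

variable (n r) in
/-- The set `σ_r` of tensors of rank at most `r`. -/
def sigma : Set (Tensor n) :=
  {B | ∃ f : Fin r → ∀ k, Fin (n k) → ℝ, B = ∑ i, elementary (f i)}

/-- The rank of a tensor. -/
def tensorRank (B : Tensor n) : ℕ := sInf {s | ∃ a ∈ segreTuples n s, addMap a = B}

/-- The action of a permutation on tuples. -/
def permTuple (π : Equiv.Perm (Fin r)) (a : Tuple n r) : Tuple n r :=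
  WithLp.toLp 2 (fun i => a (π⁻¹ i))

variable (r) in
/-- `B` has rank `r`, and its decomposition into `r` tensors of rank one is unique up to order. -/
def IsIdentifiable (B : Tensor n) : Prop :=
  tensorRank B = r ∧
    ∀ a ∈ segreTuples n r, ∀ b ∈ segreTuples n r, addMap a = B → addMap b = B →
      ∃ π, permTuple π a = b

/-- The ideal of the real polynomials that vanish on `V`. -/
def vanIdeal (V : Set (Tensor n)) : Ideal (MvPolynomial (∀ k, Fin (n k)) ℝ) :=
  MvPolynomial.vanishingIdeal ℝ (WithLp.ofLp '' V)

/-- The real Zariski closure: the smallest real algebraic variety that contains `V`. -/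
def zariskiClosure (V : Set (Tensor n)) : Set (Tensor n) :=
  {A | A.ofLp ∈ MvPolynomial.zeroLocus ℝ (vanIdeal V)}

variable (n r) in
/-- Generic `r`-identifiability: there is a proper Zariski closed subset `Z` of the Zariski closure
of `σ_r` such that every element of `σ_r` outside `Z` is `r`-identifiable. -/
def GenericallyIdentifiable : Prop :=
  ∃ Z : Set (Tensor n), zariskiClosure Z = Z ∧ Z ⊂ zariskiClosure (sigma n r) ∧
    ∀ B ∈ sigma n r, B ∉ Z → IsIdentifiable r B

/-- The Zariski tangent space at `A` of the variety with ideal `I`. -/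
def zariskiTangent (I : Ideal (MvPolynomial (∀ k, Fin (n k)) ℝ)) (A : Tensor n) :
    Submodule ℝ (Tensor n) where
  carrier := {v | ∀ p ∈ I, ∑ i, MvPolynomial.eval A.ofLp (MvPolynomial.pderiv i p) * v i = 0}
  zero_mem' := by intro p _; simp
  add_mem' := by
    intro v w hv hw p hp
    simp [mul_add, Finset.sum_add_distrib, hv p hp, hw p hp]
  smul_mem' := by
    intro c v hv p hp
    have := hv p hp
    simp only [PiLp.smul_apply, smul_eq_mul]
    rw [← mul_zero c, ← this, Finset.mul_sum]
    exact Finset.sum_congr rfl fun i _ => by ring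

/-- `A` is a smooth point of the variety `zariskiClosure V` (which is meant to be irreducible): it
lies on it, and its Zariski tangent space there has the dimension of the variety, that is, the
transcendence degree of the coordinate ring. -/
def IsSmoothPoint (V : Set (Tensor n)) (A : Tensor n) : Prop :=
  A ∈ zariskiClosure V ∧
    (Module.finrank ℝ (zariskiTangent (vanIdeal V) A) : Cardinal) =
      Algebra.trdeg ℝ (MvPolynomial (∀ k, Fin (n k)) ℝ ⧸ vanIdeal V)

/-- `ψ` is a local inverse of `Φ_r`, taking `Φ_r(a)` to `a`: it inverts `Φ_r` on a neighbourhood `U`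
of `a` in `S × ⋯ × S`, and it is continuous on `Φ_r(U)`, where it is considered. -/
structure IsLocalInverse (a : Tuple n r) (U : Set (Tuple n r)) (ψ : Tensor n → Tuple n r) :
    Prop where
  subset : U ⊆ segreTuples n r
  mem_nhds : U ∈ nhdsWithin a (segreTuples n r)
  left_inv : ∀ b ∈ U, ψ (addMap b) = b
  continuousOn : ContinuousOn ψ (addMap '' U)

/-- The condition number of the decomposition `a` of `A = Φ_r(a)`,
`lim_{ε → 0} sup {‖ψ(A) - ψ(B)‖ / ‖A - B‖ : B of rank r, ‖A - B‖ < ε}`, where `ψ` is the local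
inverse of `Φ_r` with `ψ(A) = a`, and `B` runs through the domain of `ψ`. The supremum is monotone
in `ε`, so the limit is an infimum. The value does not depend on the local inverse; the infimum over
all of them takes care of the convention that it is `∞` if there is none. -/
def kappa (a : Tuple n r) : ENNReal :=
  ⨅ (U : Set (Tuple n r)) (ψ : Tensor n → Tuple n r) (_ : IsLocalInverse a U ψ),
    ⨅ (ε : ℝ) (_ : 0 < ε),
      ⨆ (B : Tensor n) (_ : B ∈ addMap '' U ∧ tensorRank B = r ∧ B ≠ addMap a ∧
          ‖addMap a - B‖ < ε),
        ENNReal.ofReal (‖ψ (addMap a) - ψ B‖ / ‖addMap a - B‖)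

/-- General linear position: any `min r N` of the `r` vectors in `ℝ^N` are linearly independent. -/
def GLP {ι : Type} [Fintype ι] (v : Fin r → ι → ℝ) : Prop :=
  ∀ J : Finset (Fin r), J.card = min r (Fintype.card ι) → LinearIndependent ℝ (fun i : J => v i)

/-- Super general linear position: for every nonempty `h ⊆ {1, …, d}`, the partial tensor products
of the factors with index in `h` are in general linear position. -/
def SGLP (a : Tuple n r) : Prop :=
  ∃ f : Fin r → ∀ k, Fin (n k) → ℝ, (∀ i, a i = elementary (f i)) ∧
    ∀ h : Finset (Fin d), h.Nonempty →
      GLP (fun i (idx : ∀ k : h, Fin (n k)) => ∏ k : h, f i k (idx k))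

variable (n r) in
/-- Ordered `r`-nice decompositions. -/
structure IsNice [∀ k, NeZero (n k)] (a : Tuple n r) : Prop where
  mem_segre : a ∈ segreTuples n r
  smooth : IsSmoothPoint (sigma n r) (addMap a)
  identifiable : IsIdentifiable r (addMap a)
  finite_cond : kappa a ≠ ⊤
  sglp : SGLP a
  corner : ∀ i, a i (fun _ => 0) ≠ 0

variable (n r) in
/-- The set `M` of ordered `r`-nice decompositions. -/
def niceTuples [∀ k, NeZero (n k)] : Set (Tuple n r) := {a | IsNice n r a}

variable (n r) in
/-- The set `N = Φ_r(M)` of `r`-nice tensors. -/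
def niceTensors [∀ k, NeZero (n k)] : Set (Tensor n) := addMap '' niceTuples n r

/-! The symmetric group acts on `M`. -/

@[simp] lemma permTuple_apply (π : Equiv.Perm (Fin r)) (a : Tuple n r) (i : Fin r) :
    permTuple π a i = a (π⁻¹ i) := rfl

lemma permTuple_mul (π ρ : Equiv.Perm (Fin r)) (a : Tuple n r) :
    permTuple (π * ρ) a = permTuple π (permTuple ρ a) := by
  ext i : 1
  rw [permTuple_apply, permTuple_apply, permTuple_apply, mul_inv_rev, Equiv.Perm.mul_apply]

@[simp] lemma permTuple_one (a : Tuple n r) : permTuple 1 a = a := by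
  ext i : 1
  rw [permTuple_apply, inv_one, Equiv.Perm.one_apply]

@[simp] lemma permTuple_inv_left (π : Equiv.Perm (Fin r)) (a : Tuple n r) :
    permTuple π⁻¹ (permTuple π a) = a := by
  rw [← permTuple_mul]; simp

@[simp] lemma permTuple_inv_right (π : Equiv.Perm (Fin r)) (a : Tuple n r) :
    permTuple π (permTuple π⁻¹ a) = a := by
  rw [← permTuple_mul]; simp

@[simp] lemma addMap_permTuple (π : Equiv.Perm (Fin r)) (a : Tuple n r) :
    addMap (permTuple π a) = addMap a :=
  Equiv.sum_comp π⁻¹ (fun i => a i)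

lemma norm_permTuple_sub (π : Equiv.Perm (Fin r)) (a b : Tuple n r) :
    ‖permTuple π a - permTuple π b‖ = ‖a - b‖ := by
  rw [PiLp.norm_eq_of_L2, PiLp.norm_eq_of_L2]
  exact congrArg _ (Equiv.sum_comp π⁻¹ (fun i => ‖(a - b) i‖ ^ 2))

lemma isometry_permTuple (π : Equiv.Perm (Fin r)) :
    Isometry (permTuple π : Tuple n r → Tuple n r) :=
  Isometry.of_dist_eq fun a b => by
    rw [dist_eq_norm, dist_eq_norm, norm_permTuple_sub]

lemma permTuple_mem_segreTuples (π : Equiv.Perm (Fin r)) {a : Tuple n r}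
    (ha : a ∈ segreTuples n r) : permTuple π a ∈ segreTuples n r :=
  fun i => ha (π⁻¹ i)

lemma IsLocalInverse.perm (π : Equiv.Perm (Fin r)) {a : Tuple n r} {U : Set (Tuple n r)}
    {ψ : Tensor n → Tuple n r} (h : IsLocalInverse a U ψ) :
    IsLocalInverse (permTuple π a) (permTuple π '' U) (fun B => permTuple π (ψ B)) where
  subset := by
    rintro _ ⟨b, hb, rfl⟩
    exact permTuple_mem_segreTuples π (h.subset hb)
  mem_nhds := by
    have hU : permTuple π '' U = permTuple π⁻¹ ⁻¹' U := by
      ext b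
      constructor
      · rintro ⟨c, hc, rfl⟩
        simpa using hc
      · intro hb
        exact ⟨_, hb, by simp⟩
    rw [hU]
    have ht : Filter.Tendsto (permTuple π⁻¹) (nhdsWithin (permTuple π a) (segreTuples n r))
        (nhdsWithin a (segreTuples n r)) := by
      refine tendsto_nhdsWithin_iff.2 ⟨?_, ?_⟩
      · have := ((isometry_permTuple (n := n) π⁻¹).continuous.tendsto (permTuple π a))
        rw [permTuple_inv_left] at this
        exact this.mono_left nhdsWithin_le_nhds
      · exact Filter.eventually_of_mem self_mem_nhdsWithin
          fun b hb => permTuple_mem_segreTuples π⁻¹ hb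
    exact ht h.mem_nhds
  left_inv := by
    rintro _ ⟨b, hb, rfl⟩
    simp [h.left_inv b hb]
  continuousOn := by
    have : addMap '' (permTuple π '' U) = addMap '' U := by
      rw [Set.image_image]; simp
    rw [this]
    exact (isometry_permTuple π).continuous.comp_continuousOn h.continuousOn

lemma kappa_permTuple_le (π : Equiv.Perm (Fin r)) (a : Tuple n r) :
    kappa (permTuple π a) ≤ kappa a := by
  refine le_iInf fun U => le_iInf fun ψ => le_iInf fun h => ?_
  refine iInf_le_of_le (permTuple π '' U) (iInf_le_of_le (fun B => permTuple π (ψ B))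
    (iInf_le_of_le (h.perm π) ?_))
  have : addMap '' (permTuple π '' U) = addMap '' U := by
    rw [Set.image_image]; simp
  simp only [addMap_permTuple, norm_permTuple_sub, this]
  exact le_rfl

lemma SGLP.perm (π : Equiv.Perm (Fin r)) {a : Tuple n r} (h : SGLP a) :
    SGLP (permTuple π a) := by
  obtain ⟨f, hf, hg⟩ := h
  refine ⟨fun i => f (π⁻¹ i), fun i => hf _, fun s hs J hJ => ?_⟩
  have h1 := hg s hs (J.map (π⁻¹ : Equiv.Perm (Fin r)).toEmbedding) (by simpa using hJ)
  let e : J → (J.map (π⁻¹ : Equiv.Perm (Fin r)).toEmbedding : Finset (Fin r)) :=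
    fun i => ⟨π⁻¹ i, Finset.mem_map.2 ⟨i, i.2, rfl⟩⟩
  have he : Function.Injective e := by
    intro i j hij
    have : (π⁻¹ : Equiv.Perm (Fin r)) i = π⁻¹ j := congrArg Subtype.val hij
    exact Subtype.ext ((π⁻¹ : Equiv.Perm (Fin r)).injective this)
  exact h1.comp e he

section Nice

variable [∀ k, NeZero (n k)]

lemma IsNice.perm (π : Equiv.Perm (Fin r)) {a : Tuple n r} (h : IsNice n r a) :
    IsNice n r (permTuple π a) where
  mem_segre := permTuple_mem_segreTuples π h.mem_segre
  smooth := by rw [addMap_permTuple]; exact h.smooth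
  identifiable := by rw [addMap_permTuple]; exact h.identifiable
  finite_cond := ne_top_of_le_ne_top h.finite_cond (kappa_permTuple_le π a)
  sglp := h.sglp.perm π
  corner := fun i => h.corner _

instance : MulAction (Equiv.Perm (Fin r)) (niceTuples n r) where
  smul π a := ⟨permTuple π a, IsNice.perm π a.2⟩
  one_smul a := Subtype.ext (permTuple_one a.1)
  mul_smul π ρ a := Subtype.ext (permTuple_mul π ρ a.1)

variable (n r) in
/-- The quotient `M̂` of `M` by the symmetric group, with the quotient topology. -/
abbrev NiceCPD : Type := MulAction.orbitRel.Quotient (Equiv.Perm (Fin r)) (niceTuples n r)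

/-- The projection `π̂ : M → M̂`, `(A₁, …, A_r) ↦ {A₁, …, A_r}`. -/
def proj (a : niceTuples n r) : NiceCPD n r := Quotient.mk _ a

/-- The addition map `M → N`. -/
def niceAdd (a : niceTuples n r) : niceTensors n r := ⟨addMap a.1, a.1, a.2, rfl⟩

/-- The tensor decomposition map `τ : N → M̂`, `A₁ + ⋯ + A_r ↦ {A₁, …, A_r}`. -/
def decompositionMap (B : niceTensors n r) : NiceCPD n r := proj ⟨B.2.choose, B.2.choose_spec.1⟩

/-- The defining property of the tensor decomposition map. -/
lemma decompositionMap_niceAdd (a : niceTuples n r) :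
    decompositionMap (niceAdd a) = proj a := by
  have hB := (niceAdd a).2.choose_spec
  obtain ⟨π, hπ⟩ := a.2.identifiable.2 a.1 a.2.mem_segre _ hB.1.mem_segre rfl hB.2
  exact Quotient.sound ⟨π, Subtype.ext hπ⟩

end Nice

end CPD

end

/-!
Fix one of the `d` factors. A rank-one tensor whose corner entry is nonzero factorizes uniquely so
that all the other factors have first entry `1`, and the remaining entries of the factors are
coordinates on the set of these tensors. So the tuples of `r` such tensors have one global chart
`chartMap : ℝ^m → S × ⋯ × S`, polynomial and with a rational inverse `chartInv`, and the addition
map becomes the polynomial map `chartSum`. The proof has three ingredients.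

*Niceness in the chart.* The image of `chartSum` is Zariski dense in the variety `V` of `σ_r`, so
there is a polynomial, not vanishing identically on the image, off whose zeros the sums are
identifiable (`GenericallyIdentifiable.exists_polynomial`); these sums have dense preimage in the
chart. Comparing
difference quotients at such points with derivatives shows that a finite condition number means that
`d chartSum` is injective, and that the condition number is the norm of `d chartMap` relative to
`d chartSum` (`kappa_chartMap`). Hence `V` has dimension `m` at a smooth point with finite condition
number, and its Zariski tangent space there is the image of `d chartSum`. Near a point where the
Zariski tangent space has dimension `m`, the variety is flattened by a change of coordinates
(`exists_flattening`), so that it is covered by the images of the tuples near the given one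
(`eventually_mem_image_of_immersion`). It follows that the identifiability of generic tensors passes
to such points in the limit (`exists_perm_eq_elementaryTuple`), and that being nice amounts to a
list of conditions (`isNice_chartMap_iff`) which is open because the dimension of the Zariski tangent
space is upper semicontinuous (`isOpen_isNice`). So `M` is parametrized by an open subset of `ℝ^m`.

*Smooth structures.* The addition map `M → N` and the projection `M → M̂` are open and locally
injective, the former again because the variety is covered locally by sums. The points of a fibre of
either are permuted by the symmetric group, which acts smoothly, so both maps descend the smooth
structure (`exists_chartedSpace_isLocalDiffeomorph`), and the decomposition map is smooth since its
composite with the addition map is the projection. The metrics of `M` and `N` are pulled back from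
the ambient spaces; the permutations are linear isometries of the ambient space of `M`, hence its
metric descends to `M̂` (`exists_isLocalIsometry_quotient`).

*Distances.* By identifiability the symmetric group acts freely (`eq_one_of_permTuple_eq`), so that
the projection is a covering. Curves in `M̂` lift to `M` with the same length, which gives the
formula for the distance (`RMetric.IsLocalIsometry.isLeast_dist`).
-/

open Set Filter Topology

/-! ### Quotients of smooth manifolds -/

section QuotientManifold

variable {m : ℕ} {M X : Type} [TopologicalSpace M] [ChartedSpace (EuclideanSpace ℝ (Fin m)) M]
  [IsManifold (𝓡 m) ∞ M] [TopologicalSpace X]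

omit [IsManifold (𝓡 m) ∞ M] in
/-- Let `e'` be the restriction of `p` to an open set on which it is a homeomorphism, and suppose
that points of `M` in the same fibre of `p` are related by smooth maps over `p`. Then the transition
map `e'⁻¹ ∘ p` is smooth wherever it is defined, because near each point it agrees with one of
those smooth maps. -/
lemma contMDiffAt_transition {p : M → X}
    (H : ∀ x y, p x = p y → ∃ g : M → M, ContMDiff (𝓡 m) (𝓡 m) ∞ g ∧ g x = y ∧
      ∀ z, p (g z) = p z)
    {e' : OpenPartialHomeomorph M X} (he' : p = e') {x : M} (hx : p x ∈ e'.target) :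
    ContMDiffAt (𝓡 m) (𝓡 m) ∞ (fun z => e'.symm (p z)) x := by
  obtain ⟨g, hg, hgx, hgp⟩ := H x (e'.symm (p x)) (by
    rw [show p (e'.symm (p x)) = e' (e'.symm (p x)) from congrFun he' _, e'.right_inv hx])
  refine hg.contMDiffAt.congr_of_eventuallyEq ?_
  have h1 : ∀ᶠ z in 𝓝 x, g z ∈ e'.source :=
    hg.continuous.continuousAt.eventually
      (e'.open_source.mem_nhds (by rw [hgx]; exact e'.map_target hx))
  filter_upwards [h1] with z hz
  rw [← hgp z, he', e'.left_inv hz]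

/-- If `p : M → X` is a surjective local homeomorphism from a smooth manifold, and points of `M` in
the same fibre of `p` are related by smooth maps over `p`, then `X` is a smooth manifold such that
`p` is a local diffeomorphism. The charts of `X` are those of `M`, composed with local inverses
of `p`. -/
theorem exists_chartedSpace_isLocalDiffeomorph {p : M → X} (hp : IsLocalHomeomorph p)
    (hs : Function.Surjective p)
    (H : ∀ x y, p x = p y → ∃ g : M → M, ContMDiff (𝓡 m) (𝓡 m) ∞ g ∧ g x = y ∧
      ∀ z, p (g z) = p z) :
    ∃ (_ : ChartedSpace (EuclideanSpace ℝ (Fin m)) X) (_ : IsManifold (𝓡 m) ∞ X),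
      IsLocalDiffeomorph (𝓡 m) (𝓡 m) ∞ p := by
  choose e hex hep using hp
  let c : M → OpenPartialHomeomorph X (EuclideanSpace ℝ (Fin m)) := fun y =>
    (e y).symm.trans (chartAt _ y)
  have hpc : ∀ y, p y ∈ (c y).source := by
    intro y
    have h1 : p y = e y y := congrFun (hep y) y
    have h2 : p y ∈ (e y).target := h1 ▸ (e y).map_source (hex y)
    simp only [c, OpenPartialHomeomorph.trans_source, OpenPartialHomeomorph.symm_source,
      mem_inter_iff, mem_preimage]
    refine ⟨h2, ?_⟩
    rw [h1, (e y).left_inv (hex y)]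
    exact mem_chart_source _ y
  -- The atlas consists of all the `c y`, so that a transition map is a transition map of `M`
  -- composed with some `e'⁻¹ ∘ p`.
  let cs : ChartedSpace (EuclideanSpace ℝ (Fin m)) X :=
    { atlas := range c
      chartAt := fun x => c (hs x).choose
      mem_chart_source := fun x => by
        have := hpc (hs x).choose
        rwa [(hs x).choose_spec] at this
      chart_mem_atlas := fun x => mem_range_self _ }
  have hman : IsManifold (𝓡 m) ∞ X := by
    refine isManifold_of_contDiffOn _ _ _ ?_
    rintro _ _ ⟨y, rfl⟩ ⟨y', rfl⟩
    rintro u ⟨hu, -⟩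
    simp only [modelWithCornersSelf_coe_symm, preimage_id_eq, id_eq,
      OpenPartialHomeomorph.trans_source, OpenPartialHomeomorph.symm_source, mem_inter_iff,
      mem_preimage, c, OpenPartialHomeomorph.trans_symm_eq_symm_trans_symm,
      OpenPartialHomeomorph.symm_symm, OpenPartialHomeomorph.coe_trans,
      Function.comp_apply] at hu
    obtain ⟨⟨hu1, hu2⟩, hu3, hu4⟩ := hu
    refine ContDiffAt.contDiffWithinAt ?_
    rw [← contMDiffAt_iff_contDiffAt]
    set z := (chartAt (EuclideanSpace ℝ (Fin m)) y).symm u with hz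
    rw [← congrFun (hep y)] at hu3 hu4
    have h1 := contMDiffAt_transition H (hep y') (x := z) hu3
    have h2 : ContMDiffAt (𝓡 m) (𝓡 m) ∞ (chartAt (EuclideanSpace ℝ (Fin m)) y).symm u :=
      (contMDiffOn_chart_symm (I := 𝓡 m) (n := ∞)).contMDiffAt
        ((chartAt _ y).open_target.mem_nhds hu1)
    have h3 : ContMDiffAt (𝓡 m) (𝓡 m) ∞ (chartAt (EuclideanSpace ℝ (Fin m)) y')
        ((e y').symm (p z)) :=
      (contMDiffOn_chart (I := 𝓡 m) (n := ∞)).contMDiffAt ((chartAt _ y').open_source.mem_nhds hu4)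
    have h4 := h3.comp u (h1.comp u h2)
    refine h4.congr_of_eventuallyEq (Eventually.of_forall fun w => ?_)
    simp [c, ← congrFun (hep y)]
  refine ⟨cs, hman, fun y => ?_⟩
  have hcm : c y ∈ IsManifold.maximalAtlas (𝓡 m) ∞ X :=
    IsManifold.subset_maximalAtlas (mem_range_self y)
  let Φ : OpenPartialHomeomorph M X := (chartAt _ y).trans (c y).symm
  have hΦ : ∀ z ∈ Φ.source, z ∈ (chartAt (EuclideanSpace ℝ (Fin m)) y).source ∧ p z = Φ z := by
    intro z hz
    simp only [Φ, c, mfld_simps] at hz ⊢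
    refine ⟨hz.1, ?_⟩
    rw [(chartAt _ y).left_inv hz.1, ← congrFun (hep y)]
  refine ⟨⟨Φ.toPartialEquiv, Φ.open_source, Φ.open_target, ?_, ?_⟩, ?_, fun z hz => (hΦ z hz).2⟩
  · exact (contMDiffOn_symm_of_mem_maximalAtlas hcm).comp
      (contMDiffOn_chart (I := 𝓡 m) (n := ∞) |>.mono fun z hz => (hΦ z hz).1)
      (fun z hz => by
        have : z ∈ Φ.source := hz
        rw [OpenPartialHomeomorph.trans_source] at this
        exact this.2)
  · exact (contMDiffOn_chart_symm (I := 𝓡 m) (n := ∞)).comp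
      ((contMDiffOn_of_mem_maximalAtlas hcm).mono fun z hz => by
        have : z ∈ Φ.target := hz
        rw [OpenPartialHomeomorph.trans_target] at this
        exact this.1)
      (fun z hz => by
        have : z ∈ Φ.target := hz
        rw [OpenPartialHomeomorph.trans_target] at this
        exact this.2)
  · change y ∈ Φ.source
    have := hpc y
    rw [show p y = e y y from congrFun (hep y) y] at this
    simp only [Φ, c, mfld_simps] at this ⊢
    exact hex y

omit [IsManifold (𝓡 m) ∞ M] in
/-- A map out of the base of a surjective local diffeomorphism is smooth as soon as its composite
with the local diffeomorphism is. -/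
lemma ContMDiff.of_comp_isLocalDiffeomorph [ChartedSpace (EuclideanSpace ℝ (Fin m)) X]
    {G H Y : Type*} [NormedAddCommGroup G] [NormedSpace ℝ G] [TopologicalSpace H]
    {J : ModelWithCorners ℝ G H} [TopologicalSpace Y] [ChartedSpace H Y]
    {p : M → X} (hp : IsLocalDiffeomorph (𝓡 m) (𝓡 m) ∞ p) (hs : Function.Surjective p)
    {f : X → Y} (hf : ContMDiff (𝓡 m) J ∞ (f ∘ p)) : ContMDiff (𝓡 m) J ∞ f := by
  intro x
  obtain ⟨y, rfl⟩ := hs x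
  have h1 := (hf.contMDiffAt (x := (hp y).localInverse (p y))).comp (p y)
    (hp y).localInverse_contMDiffAt
  refine h1.congr_of_eventuallyEq ?_
  filter_upwards [(hp y).localInverse_eventuallyEq_right] with z hz
  exact (congrArg f hz).symm

end QuotientManifold

/-! ### Riemannian metrics induced by families of immersions -/

section PullbackMetric

variable {m : ℕ} {X : Type} [TopologicalSpace X] [ChartedSpace (EuclideanSpace ℝ (Fin m)) X]
  [IsManifold (𝓡 m) ∞ X] {F : Type} [NormedAddCommGroup F] [InnerProductSpace ℝ F]

/-- The pullback `(v, w) ↦ ⟪D v, D w⟫` of the inner product by a continuous linear map `D`. -/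
noncomputable def pullbackInner {G : Type*} [NormedAddCommGroup G] [NormedSpace ℝ G]
    (D : G →L[ℝ] F) : G →L[ℝ] G →L[ℝ] ℝ :=
  ((ContinuousLinearMap.compL ℝ G F ℝ).flip D) ∘L ((innerSL ℝ : F →L[ℝ] F →L[ℝ] ℝ) ∘L D)

@[simp] lemma pullbackInner_apply {G : Type*} [NormedAddCommGroup G] [NormedSpace ℝ G]
    (D : G →L[ℝ] F) (v w : G) : pullbackInner D v w = inner ℝ (D v) (D w) := rfl

/-- The pullback of the Euclidean inner product along a smooth map is a smooth section. In the
trivialization of the tangent bundle at `x₀` it is the pullback by the differential of the map, read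
in these coordinates. -/
lemma contMDiffAt_pullbackInner {ι : X → F} {x₀ : X}
    (hι : ContMDiffAt (𝓡 m) 𝓘(ℝ, F) ∞ ι x₀)
    (B : ∀ x : X, TangentSpace (𝓡 m) x →L[ℝ] TangentSpace (𝓡 m) x →L[ℝ] ℝ)
    (hB : ∀ᶠ x in 𝓝 x₀, ∀ v w, B x v w =
      @inner ℝ F _ (mfderiv (𝓡 m) 𝓘(ℝ, F) ι x v) (mfderiv (𝓡 m) 𝓘(ℝ, F) ι x w)) :
    ContMDiffAt (𝓡 m) ((𝓡 m).prod 𝓘(ℝ, EuclideanSpace ℝ (Fin m) →L[ℝ]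
      EuclideanSpace ℝ (Fin m) →L[ℝ] ℝ)) ∞
      (fun x => Bundle.TotalSpace.mk' (EuclideanSpace ℝ (Fin m) →L[ℝ]
        EuclideanSpace ℝ (Fin m) →L[ℝ] ℝ) (E := fun x : X => TangentSpace (𝓡 m) x →L[ℝ]
          TangentSpace (𝓡 m) x →L[ℝ] ℝ) x (B x)) x₀ := by
  rw [contMDiffAt_hom_bundle]
  refine ⟨contMDiffAt_id, ?_⟩
  have hJ := hι.mfderiv_const (m := ∞) (by simp)
  set J := inTangentCoordinates (𝓡 m) 𝓘(ℝ, F) id ι (mfderiv (𝓡 m) 𝓘(ℝ, F) ι) x₀ with hJdef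
  have h1 : ContMDiffAt (𝓡 m) 𝓘(ℝ, EuclideanSpace ℝ (Fin m) →L[ℝ]
      EuclideanSpace ℝ (Fin m) →L[ℝ] ℝ) ∞ (fun x => pullbackInner (J x)) x₀ := by
    unfold pullbackInner
    refine ContMDiffAt.clm_comp ?_ (ContMDiffAt.clm_comp contMDiffAt_const hJ)
    have h2 : ContDiff ℝ ∞ (fun D : EuclideanSpace ℝ (Fin m) →L[ℝ] F =>
        (ContinuousLinearMap.compL ℝ (EuclideanSpace ℝ (Fin m)) F ℝ).flip D) :=
      ContinuousLinearMap.contDiff _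
    exact h2.contMDiff.contMDiffAt.comp x₀ hJ
  refine h1.congr_of_eventuallyEq ?_
  filter_upwards [hB, (trivializationAt (EuclideanSpace ℝ (Fin m))
    (TangentSpace (𝓡 m) : X → Type) x₀).open_baseSet.mem_nhds
    (FiberBundle.mem_baseSet_trivializationAt' x₀)] with x hx hxb
  ext v w
  rw [inCoordinates_apply_eq₂ hxb hxb (by simp), pullbackInner_apply]
  have hJx : ∀ v, J x v = mfderiv (𝓡 m) 𝓘(ℝ, F) ι x
      ((trivializationAt (EuclideanSpace ℝ (Fin m)) (TangentSpace (𝓡 m)) x₀).symm x v) := by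
    intro v
    rw [hJdef]
    simp only [inTangentCoordinates, id]
    rw [ContinuousLinearMap.inCoordinates_eq hxb (by
      rw [TangentBundle.trivializationAt_baseSet, chartAt_self_eq]; trivial)]
    simp
    rfl
  rw [hJx, hJx]
  simp [hx]

/-- The pulled back inner product is bounded below on the unit sphere. -/
lemma isVonNBounded_pullbackInner {G : Type*} [NormedAddCommGroup G] [NormedSpace ℝ G]
    [FiniteDimensional ℝ G] (D : G →L[ℝ] F) (hD : Function.Injective D) :
    Bornology.IsVonNBounded ℝ {v : G | pullbackInner D v v < 1} := by
  obtain ⟨K, hK, hKD⟩ := D.toLinearMap.exists_antilipschitzWith (LinearMap.ker_eq_bot.2 hD)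
  rw [NormedSpace.isVonNBounded_iff, Metric.isBounded_iff_subset_closedBall 0]
  refine ⟨K, fun v hv => ?_⟩
  rw [mem_closedBall_zero_iff]
  have h1 : ‖D v‖ ≤ 1 := by
    have : ‖D v‖ ^ 2 < 1 := by simpa [real_inner_self_eq_norm_sq] using hv
    nlinarith [norm_nonneg (D v)]
  have h2 := hKD.le_mul_norm_sub 0 v
  simp only [map_zero] at h2
  calc ‖v‖ ≤ K * ‖D v‖ := by simpa using h2
    _ ≤ K := mul_le_of_le_one_right K.2 h1

/-- A family of local immersions `ι x`, each defined near `x`, into a Euclidean space induces a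
Riemannian metric, provided that the members of the family differ only by linear isometries of the
Euclidean space wherever they are both considered. -/
theorem exists_rMetric_of_immersions (ι : X → X → F)
    (hι : ∀ x, ContMDiffAt (𝓡 m) 𝓘(ℝ, F) ∞ (ι x) x)
    (hinj : ∀ x, Function.Injective (mfderiv (𝓡 m) 𝓘(ℝ, F) (ι x) x))
    (hc : ∀ x₀, ∀ᶠ x in 𝓝 x₀, ∃ L : F →ₗᵢ[ℝ] F, ι x₀ =ᶠ[𝓝 x] L ∘ ι x) :
    ∃ g : RMetric m X, ∀ (x : X) (v w : TangentSpace (𝓡 m) x),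
      g.inner x v w = @inner ℝ F _ (mfderiv (𝓡 m) 𝓘(ℝ, F) (ι x) x v)
        (mfderiv (𝓡 m) 𝓘(ℝ, F) (ι x) x w) := by
  let D : ∀ x : X, EuclideanSpace ℝ (Fin m) →L[ℝ] F := fun x => mfderiv (𝓡 m) 𝓘(ℝ, F) (ι x) x
  refine ⟨⟨fun x => pullbackInner (D x), ?_, ?_, ?_, ?_⟩, fun x v w => rfl⟩
  · intro x v w
    exact real_inner_comm _ _
  · intro x v hv
    have : D x v ≠ 0 := fun h => hv (hinj x (h.trans (map_zero (D x)).symm))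
    exact real_inner_self_pos.2 this
  · exact fun x => isVonNBounded_pullbackInner (D x) (hinj x)
  · intro x₀
    refine contMDiffAt_pullbackInner (hι x₀) _ ?_
    filter_upwards [hc x₀] with x ⟨L, hL⟩ v w
    have hd : HasMFDerivAt (𝓡 m) 𝓘(ℝ, F) (ι x₀) x
        (L.toContinuousLinearMap ∘L mfderiv (𝓡 m) 𝓘(ℝ, F) (ι x) x) :=
      (L.toContinuousLinearMap.hasMFDerivAt.comp x
        ((hι x).mdifferentiableAt (by simp)).hasMFDerivAt).congr_of_eventuallyEq hL
    rw [hd.mfderiv]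
    exact (L.inner_map_map _ _).symm

end PullbackMetric

/-! ### Riemannian coverings -/

section RiemannianCovering

open MeasureTheory

variable {m : ℕ} {M X : Type}
  [TopologicalSpace M] [ChartedSpace (EuclideanSpace ℝ (Fin m)) M] [IsManifold (𝓡 m) ∞ M]
  [TopologicalSpace X] [ChartedSpace (EuclideanSpace ℝ (Fin m)) X] [IsManifold (𝓡 m) ∞ X]

namespace RMetric

open scoped Bundle

/-- The length of a curve parametrised by the unit interval. -/
noncomputable def length (g : RMetric m X) (γ : unitInterval → X) : ENNReal :=
  ∫⁻ t, ENNReal.ofReal (g.tnorm (γ t) (mfderiv (𝓡∂ 1) (𝓡 m) γ t 1))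

lemma dist_eq_iInf_length (g : RMetric m X) (x y : X) :
    g.dist x y = ⨅ (γ : Path x y) (_ : ContMDiff (𝓡∂ 1) (𝓡 m) 1 γ), g.length γ := by
  unfold RMetric.dist RMetric.length
  rw [Manifold.riemannianEDist]
  let _ : Bundle.RiemannianBundle (fun x : X => TangentSpace (𝓡 m) x) := ⟨g.toRiemannianMetric⟩
  refine iInf_congr fun γ => iInf_congr fun _ => lintegral_congr fun t => ?_
  exact (ofReal_norm (E := TangentSpace (𝓡 m) (γ t)) _).symm

namespace IsLocalIsometry

variable {g : RMetric m M} {h : RMetric m X} {p : M → X}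

lemma tnorm_mfderiv (hp : IsLocalIsometry g h p) (x : M) (v : TangentSpace (𝓡 m) x) :
    h.tnorm (p x) (mfderiv (𝓡 m) (𝓡 m) p x v) = g.tnorm x v := by
  unfold tnorm
  rw [hp.inner_eq]

lemma length_comp (hp : IsLocalIsometry g h p) {γ : unitInterval → M}
    (hγ : ContMDiff (𝓡∂ 1) (𝓡 m) 1 γ) : h.length (p ∘ γ) = g.length γ := by
  unfold length
  refine lintegral_congr fun t => ?_
  rw [mfderiv_comp t (hp.isLocalDiffeomorph.mdifferentiable (by simp) _)
    (hγ.mdifferentiable (by simp) t)]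
  exact congrArg _ (hp.tnorm_mfderiv _ _)

lemma dist_le (hp : IsLocalIsometry g h p) (a b : M) : h.dist (p a) (p b) ≤ g.dist a b := by
  rw [dist_eq_iInf_length, dist_eq_iInf_length]
  refine le_iInf fun γ => le_iInf fun hγ => ?_
  rw [← hp.length_comp hγ]
  have hpc : Continuous p := hp.isLocalDiffeomorph.contMDiff.continuous
  exact iInf_le_of_le (γ.map hpc) (iInf_le_of_le
    ((hp.isLocalDiffeomorph.contMDiff.of_le (by simp)).comp hγ) le_rfl)

/-- Curves lift along a covering that is a local isometry, with the same length. -/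
lemma exists_dist_lt (hp : IsLocalIsometry g h p) (hc : IsCoveringMap p) {a : M} {y : X}
    {ρ : ENNReal} (hρ : h.dist (p a) y < ρ) : ∃ c, p c = y ∧ g.dist a c < ρ := by
  rw [dist_eq_iInf_length] at hρ
  simp only [iInf_lt_iff] at hρ
  obtain ⟨γ, hγ, hlt⟩ := hρ
  obtain ⟨Γ, hΓ, hΓ0⟩ := hc.exists_path_lifts γ.toContinuousMap a γ.source
  -- The lift is as smooth as `γ`, being locally its composite with a local inverse of `p`.
  have hΓd : ContMDiff (𝓡∂ 1) (𝓡 m) 1 Γ := by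
    intro t
    have hl := hp.isLocalDiffeomorph (Γ t)
    have h1 : ContMDiffAt (𝓡 m) (𝓡 m) 1 hl.localInverse (γ t) := by
      rw [show γ t = p (Γ t) from (congrFun hΓ t).symm]
      exact hl.localInverse_contMDiffAt.of_le (by simp)
    refine (h1.comp t hγ.contMDiffAt).congr_of_eventuallyEq ?_
    filter_upwards [Γ.continuous.continuousAt.eventually
      hl.localInverse_eventuallyEq_left] with s hs
    rw [Function.comp_apply, show γ s = p (Γ s) from (congrFun hΓ s).symm]
    exact hs.symm
  refine ⟨Γ 1, (congrFun hΓ 1).trans γ.target, ?_⟩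
  rw [dist_eq_iInf_length]
  refine lt_of_le_of_lt (iInf_le_of_le (⟨Γ, hΓ0, rfl⟩ : Path a (Γ 1))
    (iInf_le_of_le hΓd le_rfl)) ?_
  change g.length Γ < ρ
  rw [← hp.length_comp hΓd, hΓ]
  exact hlt

/-- For the quotient by a finite group, when it is a covering and a local isometry, the distance
between two orbits is the least distance from a point of one to the points of the other. -/
theorem isLeast_dist {G : Type*} [Finite G] [SMul G M] (hp : IsLocalIsometry g h p)
    (hc : IsCoveringMap p) (hG : ∀ a b : M, p a = p b ↔ ∃ σ : G, σ • a = b) (a b : M) :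
    IsLeast (range fun σ : G => g.dist a (σ • b)) (h.dist (p a) (p b)) := by
  have hle : ∀ σ : G, h.dist (p a) (p b) ≤ g.dist a (σ • b) := fun σ => by
    rw [(hG b (σ • b)).2 ⟨σ, rfl⟩]
    exact hp.dist_le a _
  refine ⟨?_, by rintro _ ⟨σ, rfl⟩; exact hle σ⟩
  obtain ⟨σ₁, -⟩ := (hG b b).1 rfl
  have : Nonempty G := ⟨σ₁⟩
  obtain ⟨σ, hσ⟩ := Finite.exists_min fun σ : G => g.dist a (σ • b)
  refine ⟨σ, le_antisymm (le_of_forall_gt fun ρ hρ => ?_) (hle σ)⟩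
  obtain ⟨c, hc1, hc2⟩ := hp.exists_dist_lt hc hρ
  obtain ⟨σ', rfl⟩ := (hG b c).1 hc1.symm
  exact (hσ σ').trans_lt hc2

end IsLocalIsometry

end RMetric

end RiemannianCovering

/-! ### The chart of the tuples of rank-one tensors -/

namespace CPD

variable {d : ℕ} {n : Fin d → ℕ} {r m : ℕ}

/-- The tuple of the elementary tensors of `r` families of factors. -/
noncomputable def elementaryTuple (b : Fin r → ∀ k, Fin (n k) → ℝ) : Tuple n r :=
  WithLp.toLp 2 (fun i => elementary (b i))

@[simp] lemma elementaryTuple_apply (b : Fin r → ∀ k, Fin (n k) → ℝ) (i : Fin r) :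
    elementaryTuple b i = elementary (b i) := rfl

lemma addMap_elementaryTuple (b : Fin r → ∀ k, Fin (n k) → ℝ) :
    addMap (elementaryTuple b) = ∑ i, elementary (b i) := rfl

lemma addMap_elementaryTuple_mem_sigma (b : Fin r → ∀ k, Fin (n k) → ℝ) :
    addMap (elementaryTuple b) ∈ sigma n r := ⟨b, rfl⟩

lemma addMap_apply (a : Tuple n r) (idx : ∀ k, Fin (n k)) : addMap a idx = ∑ i, a i idx := by
  simp [addMap]

variable (n r) in
/-- The addition map `Φ_r` as a continuous linear map on all tuples of tensors. -/
noncomputable def addCLM : Tuple n r →L[ℝ] Tensor n :=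
  ∑ i, PiLp.proj 2 (fun _ : Fin r => Tensor n) i

@[simp] lemma addCLM_apply (a : Tuple n r) : addCLM n r a = addMap a := by
  simp [addCLM, addMap]

lemma continuous_addMap : Continuous (addMap : Tuple n r → Tensor n) :=
  (addCLM n r).continuous.congr addCLM_apply

lemma contDiff_addMap : ContDiff ℝ ω (addMap : Tuple n r → Tensor n) := by
  have h : ContDiff ℝ ω (addCLM n r) := ContinuousLinearMap.contDiff _
  exact (funext addCLM_apply : ⇑(addCLM n r) = addMap) ▸ h

lemma contDiff_elementaryTuple :
    ContDiff ℝ ω (elementaryTuple : (Fin r → ∀ k, Fin (n k) → ℝ) → Tuple n r) := by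
  refine contDiff_piLp' 2 fun i => contDiff_piLp' 2 fun idx => ?_
  have h : ContDiff ℝ ω fun b : Fin r → ∀ k, Fin (n k) → ℝ => ∏ k, b i k (idx k) :=
    contDiff_prod fun k _ =>
      contDiff_pi.1 (contDiff_pi.1 (contDiff_pi.1 contDiff_id i) k) (idx k)
  exact h

/-- The linear action of a permutation on tuples of tensors. -/
noncomputable def permLinearIsometry (π : Equiv.Perm (Fin r)) : Tuple n r →ₗᵢ[ℝ] Tuple n r where
  toFun := permTuple π
  map_add' _ _ := rfl
  map_smul' _ _ := rfl
  norm_map' a := by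
    have h := norm_permTuple_sub π a 0
    rwa [show permTuple π (0 : Tuple n r) = 0 from rfl, sub_zero, sub_zero] at h

lemma contDiff_permTuple (π : Equiv.Perm (Fin r)) :
    ContDiff ℝ ω (permTuple π : Tuple n r → Tuple n r) :=
  (permLinearIsometry π).contDiff

/-- The partial tensor products of `r` families of factors are in general linear position. -/
def FactorsSGLP (f : Fin r → ∀ k, Fin (n k) → ℝ) : Prop :=
  ∀ h : Finset (Fin d), h.Nonempty →
    GLP (fun i (idx : ∀ k : h, Fin (n k)) => ∏ k : h, f i k (idx k))

/-- General linear position of the partial tensor products does not change when the factors are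
rescaled by nonzero scalars. -/
lemma FactorsSGLP.of_smul {f g : Fin r → ∀ k, Fin (n k) → ℝ} (hg : FactorsSGLP g)
    (c : Fin r → Fin d → ℝ) (hc : ∀ i k, c i k ≠ 0) (hf : ∀ i k j, f i k j = c i k * g i k j) :
    FactorsSGLP f := by
  intro h hh J hJ
  have h1 := (hg h hh J hJ).units_smul
    (fun i : J => Units.mk0 (∏ k : h, c i k) (Finset.prod_ne_zero_iff.2 fun k _ => hc i k))
  convert h1 using 1
  ext i idx
  simp [hf, Finset.prod_mul_distrib, Units.smul_def]

/-- General linear position of the partial tensor products is an open condition. -/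
lemma isOpen_factorsSGLP : IsOpen {f : Fin r → ∀ k, Fin (n k) → ℝ | FactorsSGLP f} := by
  have h1 : {f : Fin r → ∀ k, Fin (n k) → ℝ | FactorsSGLP f} =
      ⋂ (h : Finset (Fin d)) (_ : h.Nonempty) (J : Finset (Fin r))
        (_ : J.card = min r (Fintype.card (∀ k : h, Fin (n k)))),
        (fun (f : Fin r → ∀ k, Fin (n k) → ℝ) (i : J) (idx : ∀ k : h, Fin (n k)) =>
          ∏ k : h, f i k (idx k)) ⁻¹' {v | LinearIndependent ℝ v} := by
    ext f
    simp [FactorsSGLP, GLP]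
  rw [h1]
  refine isOpen_iInter_of_finite fun h => isOpen_iInter_of_finite fun _ =>
    isOpen_iInter_of_finite fun J => isOpen_iInter_of_finite fun _ =>
    isOpen_setOfPred_linearIndependent.preimage ?_
  fun_prop

section Chart

variable [∀ k, NeZero (n k)]

variable (n) in
/-- The coordinates on the rank-one tensors with nonzero corner entry: such a tensor is uniquely
`a¹ ⊗ ⋯ ⊗ a^d` where all the factors except the one with index `k₀` have first entry `1`, and its
coordinates are the remaining entries of the factors. -/
abbrev ChartIndex (k₀ : Fin d) : Type := {p : Σ k, Fin (n k) // p.2 ≠ 0 ∨ p.1 = k₀}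

lemma card_chartIndex (k₀ : Fin d) :
    Fintype.card (ChartIndex n k₀) = 1 + ∑ k, (n k - 1) := by
  have h1 : ∀ k, Fintype.card {j : Fin (n k) // j ≠ 0 ∨ k = k₀} =
      (n k - 1) + if k = k₀ then 1 else 0 := by
    intro k
    have hk : 0 < n k := Nat.pos_of_ne_zero (NeZero.ne _)
    by_cases h : k = k₀
    · simp only [h, or_true, if_true]
      rw [Fintype.card_congr (Equiv.subtypeUnivEquiv fun _ => trivial), Fintype.card_fin]
      subst h
      omega
    · simp [h, Fintype.card_subtype_compl]
  have e : ChartIndex n k₀ ≃ Σ k, {j : Fin (n k) // j ≠ 0 ∨ k = k₀} :=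
    { toFun := fun p => ⟨p.1.1, p.1.2, p.2⟩
      invFun := fun p => ⟨⟨p.1, p.2.1⟩, p.2.2⟩
      left_inv := fun _ => rfl
      right_inv := fun _ => rfl }
  rw [Fintype.card_congr e, Fintype.card_sigma]
  simp [h1, Finset.sum_add_distrib, add_comm]

variable {k₀ : Fin d} (e : Fin r × ChartIndex n k₀ ≃ Fin m)

/-- The factors of the tuple with given coordinates. -/
noncomputable def chartFactors (x : EuclideanSpace ℝ (Fin m)) : Fin r → ∀ k, Fin (n k) → ℝ :=
  fun i k j => if h : j ≠ 0 ∨ k = k₀ then x (e (i, ⟨⟨k, j⟩, h⟩)) else 1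

/-- The tuple of rank-one tensors with given coordinates. -/
noncomputable def chartMap (x : EuclideanSpace ℝ (Fin m)) : Tuple n r :=
  elementaryTuple (chartFactors e x)

/-- The coordinates of a tuple of rank-one tensors with nonzero corner entries, as rational
functions of their entries. -/
noncomputable def chartInv (a : Tuple n r) : EuclideanSpace ℝ (Fin m) :=
  WithLp.toLp 2 fun s =>
    a (e.symm s).1 (Function.update 0 (e.symm s).2.1.1 (e.symm s).2.1.2) /
      if (e.symm s).2.1.1 = k₀ then 1 else a (e.symm s).1 0

lemma chartInv_apply (a : Tuple n r) (i : Fin r) (p : ChartIndex n k₀) :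
    chartInv e a (e (i, p)) =
      a i (Function.update 0 p.1.1 p.1.2) / if p.1.1 = k₀ then 1 else a i 0 := by
  change (fun q : Fin r × ChartIndex n k₀ => a q.1 (Function.update 0 q.2.1.1 q.2.1.2) /
    if q.2.1.1 = k₀ then 1 else a q.1 0) (e.symm (e (i, p))) = _
  rw [Equiv.symm_apply_apply]

lemma contDiff_chartFactors : ContDiff ℝ ω (chartFactors e) := by
  refine contDiff_pi.2 fun i => contDiff_pi.2 fun k => contDiff_pi.2 fun j => ?_
  unfold chartFactors
  split_ifs with h
  · exact contDiff_piLp_apply (p := 2)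
  · exact contDiff_const

lemma contDiff_chartMap : ContDiff ℝ ω (chartMap e) :=
  contDiff_elementaryTuple.comp (contDiff_chartFactors e)

lemma contDiffAt_chartInv {a : Tuple n r} (ha : ∀ i, a i 0 ≠ 0) :
    ContDiffAt ℝ ω (chartInv e) a := by
  refine contDiffAt_piLp' 2 fun s => ?_
  have h1 : ∀ i idx, ContDiffAt ℝ ω (fun a : Tuple n r => a i idx) a := fun i idx =>
    ((contDiff_piLp_apply (p := 2) (i := idx)).comp
      (contDiff_piLp_apply (p := 2) (i := i))).contDiffAt
  refine (h1 _ _).div ?_ ?_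
  · split_ifs
    · exact contDiffAt_const
    · exact h1 _ _
  · split_ifs
    · exact one_ne_zero
    · exact ha _

lemma prod_update_zero (f : ∀ k, Fin (n k) → ℝ) (k : Fin d) (j : Fin (n k)) :
    ∏ l, f l (Function.update (0 : ∀ k, Fin (n k)) k j l) =
      f k j * ∏ l ∈ Finset.univ.erase k, f l 0 := by
  rw [← Finset.mul_prod_erase _ _ (Finset.mem_univ k), Function.update_self]
  congr 1
  refine Finset.prod_congr rfl fun l hl => ?_
  rw [Function.update_of_ne (Finset.ne_of_mem_erase hl)]
  rfl

lemma chartFactors_zero (x : EuclideanSpace ℝ (Fin m)) (i : Fin r) {k : Fin d} (hk : k ≠ k₀) :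
    chartFactors e x i k 0 = 1 := by
  simp [chartFactors, hk]

lemma chartMap_corner (x : EuclideanSpace ℝ (Fin m)) (i : Fin r) :
    chartMap e x i 0 = x (e (i, ⟨⟨k₀, 0⟩, Or.inr rfl⟩)) := by
  change ∏ l, chartFactors e x i l ((0 : ∀ k, Fin (n k)) l) = _
  rw [← Finset.mul_prod_erase _ _ (Finset.mem_univ k₀), Finset.prod_eq_one, mul_one]
  · simp [chartFactors]
  · intro l hl
    exact chartFactors_zero e x i (Finset.ne_of_mem_erase hl)

lemma chartInv_chartMap {x : EuclideanSpace ℝ (Fin m)} (hx : ∀ i, chartMap e x i 0 ≠ 0) :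
    chartInv e (chartMap e x) = x := by
  ext s
  obtain ⟨⟨i, ⟨⟨k, j⟩, hj⟩⟩, rfl⟩ := e.surjective s
  rw [chartInv_apply]
  have h1 : chartMap e x i (Function.update 0 k j) =
      chartFactors e x i k j * ∏ l ∈ Finset.univ.erase k, chartFactors e x i l 0 :=
    prod_update_zero _ _ _
  have h2 : chartFactors e x i k j = x (e (i, ⟨⟨k, j⟩, hj⟩)) := by
    simp only at hj
    simp [chartFactors, hj]
  rw [h1, h2]
  by_cases hk : k = k₀
  · subst hk
    rw [Finset.prod_eq_one fun l hl => chartFactors_zero e x i (Finset.ne_of_mem_erase hl)]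
    simp
  · have h3 : chartMap e x i 0 = ∏ l ∈ Finset.univ.erase k, chartFactors e x i l 0 := by
      change ∏ l, chartFactors e x i l ((0 : ∀ k, Fin (n k)) l) = _
      rw [← Finset.mul_prod_erase _ _ (Finset.mem_univ k)]
      simp only [Pi.zero_apply]
      rw [chartFactors_zero e x i hk, one_mul]
    rw [if_neg hk, h3, mul_div_assoc, div_self (h3 ▸ hx i), mul_one]

/-- Passing to the coordinates and back rescales the factors by scalars with product `1`. -/
lemma exists_chartFactors_chartInv {b : Fin r → ∀ k, Fin (n k) → ℝ} (hb : ∀ i k, b i k 0 ≠ 0) :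
    ∃ c : Fin r → Fin d → ℝ, (∀ i k, c i k ≠ 0) ∧ (∀ i, ∏ k, c i k = 1) ∧
      ∀ i k j, chartFactors e (chartInv e (elementaryTuple b)) i k j = c i k * b i k j := by
  refine ⟨fun i k => if k = k₀ then ∏ l ∈ Finset.univ.erase k₀, b i l 0 else (b i k 0)⁻¹,
    ?_, ?_, ?_⟩
  · intro i k
    dsimp only
    split_ifs
    · exact Finset.prod_ne_zero_iff.2 fun l _ => hb i l
    · exact inv_ne_zero (hb i k)
  · intro i
    rw [← Finset.mul_prod_erase _ _ (Finset.mem_univ k₀)]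
    simp only [if_true]
    rw [Finset.prod_congr rfl (fun l hl => if_neg (Finset.ne_of_mem_erase hl)),
      ← Finset.prod_mul_distrib]
    exact Finset.prod_eq_one fun l _ => mul_inv_cancel₀ (hb i l)
  · intro i k j
    have h1 : elementary (b i) (Function.update 0 k j) =
        b i k j * ∏ l ∈ Finset.univ.erase k, b i l 0 := prod_update_zero _ _ _
    have h2 : elementary (b i) 0 = b i k 0 * ∏ l ∈ Finset.univ.erase k, b i l 0 :=
      (Finset.mul_prod_erase _ _ (Finset.mem_univ k)).symm
    have h3 : ∏ l ∈ Finset.univ.erase k, b i l 0 ≠ 0 :=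
      Finset.prod_ne_zero_iff.2 fun l _ => hb i l
    by_cases hk : k = k₀
    · subst hk
      simp [chartFactors, chartInv_apply, h1, mul_comm]
    · by_cases hj : j = 0
      · subst hj
        simp [chartFactors, hk, inv_mul_cancel₀ (hb i k)]
      · simp only [chartFactors, hj, ne_eq, not_false_eq_true, true_or, dif_pos, chartInv_apply,
          hk, if_false, elementaryTuple_apply, h1, h2]
        rw [mul_div_mul_right _ _ h3, div_eq_inv_mul]

lemma chartMap_chartInv_elementaryTuple {b : Fin r → ∀ k, Fin (n k) → ℝ}
    (hb : ∀ i k, b i k 0 ≠ 0) :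
    chartMap e (chartInv e (elementaryTuple b)) = elementaryTuple b := by
  obtain ⟨c, -, hc1, hc⟩ := exists_chartFactors_chartInv e hb
  ext i idx
  change ∏ k, chartFactors e (chartInv e (elementaryTuple b)) i k (idx k) = ∏ k, b i k (idx k)
  simp_rw [hc, Finset.prod_mul_distrib, hc1, one_mul]

lemma ne_zero_of_corner {f : ∀ k, Fin (n k) → ℝ} (hf : elementary f 0 ≠ 0) (k : Fin d) :
    f k 0 ≠ 0 :=
  Finset.prod_ne_zero_iff.1 (show ∏ k, f k ((0 : ∀ k, Fin (n k)) k) ≠ 0 from hf) k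
    (Finset.mem_univ k)

omit [∀ k, NeZero (n k)] in
lemma exists_elementaryTuple {a : Tuple n r} (ha : a ∈ segreTuples n r) :
    ∃ b, a = elementaryTuple b := by
  choose b hb using fun i => (ha i).2
  exact ⟨b, by ext i : 1; exact hb i⟩

lemma chartMap_chartInv {a : Tuple n r} (ha : a ∈ segreTuples n r) (h0 : ∀ i, a i 0 ≠ 0) :
    chartMap e (chartInv e a) = a := by
  obtain ⟨b, rfl⟩ := exists_elementaryTuple ha
  exact chartMap_chartInv_elementaryTuple e fun i => ne_zero_of_corner (h0 i)

lemma chartMap_mem_segreTuples {x : EuclideanSpace ℝ (Fin m)}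
    (hx : ∀ i, chartMap e x i 0 ≠ 0) : chartMap e x ∈ segreTuples n r :=
  fun i => ⟨fun h => hx i (by rw [h]; rfl), _, rfl⟩

lemma isOpen_corner : IsOpen {x : EuclideanSpace ℝ (Fin m) | ∀ i, chartMap e x i 0 ≠ 0} := by
  simp only [ofPred_forall]
  refine isOpen_iInter_of_finite fun i => ?_
  refine isOpen_ne_fun ?_ continuous_const
  simp only [chartMap_corner]
  fun_prop

/-- Super general linear position can be tested on the factors given by the coordinates. -/
lemma sglp_chartMap_iff {x : EuclideanSpace ℝ (Fin m)} (hx : ∀ i, chartMap e x i 0 ≠ 0) :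
    SGLP (chartMap e x) ↔ FactorsSGLP (chartFactors e x) := by
  refine ⟨?_, fun h => ⟨_, fun i => rfl, h⟩⟩
  rintro ⟨f, hf, hg⟩
  have h1 : chartMap e x = elementaryTuple f := by ext i : 1; exact hf i
  have hf0 : ∀ i k, f i k 0 ≠ 0 := fun i => ne_zero_of_corner (by rw [← hf]; exact hx i)
  obtain ⟨c, hc0, -, hc⟩ := exists_chartFactors_chartInv e hf0
  rw [← h1, chartInv_chartMap e hx] at hc
  exact FactorsSGLP.of_smul hg c hc0 hc

end Chart

end CPD

/-! ### Zariski tangent spaces and immersions into varieties -/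

/-- The set where an analytic function on a real normed space is nonzero is dense, unless the
function vanishes identically. -/
lemma ContDiff.dense_ne_zero {V : Type*} [NormedAddCommGroup V] [NormedSpace ℝ V] {G : V → ℝ}
    (hG : ContDiff ℝ ω G) {x₀ : V} (hx₀ : G x₀ ≠ 0) : Dense {x | G x ≠ 0} := by
  intro x
  by_contra hx
  -- Otherwise the function vanishes near `x`, hence everywhere, by the identity theorem.
  have h1 : G =ᶠ[𝓝 x] 0 := by
    rw [mem_closure_iff_frequently, not_frequently] at hx
    filter_upwards [hx] with y hy
    simpa using hy
  have h2 : AnalyticOnNhd ℝ G univ := fun y _ => hG.contDiffAt.analyticAt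
  exact hx₀ (h2.eqOn_zero_of_preconnected_of_eventuallyEq_zero isPreconnected_univ (mem_univ x) h1
    (mem_univ x₀))

namespace CPD

variable {d : ℕ} {n : Fin d → ℕ} {r m : ℕ}

section Polynomial

/-- The gradient at `A` of a polynomial in the entries of a tensor. -/
noncomputable def polyGrad (A : Tensor n) :
    MvPolynomial (∀ k, Fin (n k)) ℝ →ₗ[ℝ] Tensor n where
  toFun p := WithLp.toLp 2 fun i => MvPolynomial.eval A.ofLp (MvPolynomial.pderiv i p)
  map_add' p q := by ext i; simp
  map_smul' c p := by ext i; simp [MvPolynomial.smul_eval]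

@[simp] lemma polyGrad_apply (A : Tensor n) (p : MvPolynomial (∀ k, Fin (n k)) ℝ)
    (i : ∀ k, Fin (n k)) :
    polyGrad A p i = MvPolynomial.eval A.ofLp (MvPolynomial.pderiv i p) := rfl

lemma contDiff_eval (p : MvPolynomial (∀ k, Fin (n k)) ℝ) :
    ContDiff ℝ ω (fun B : Tensor n => MvPolynomial.eval B.ofLp p) := by
  induction p using MvPolynomial.induction_on with
  | C a => simpa using contDiff_const
  | add p q hp hq => simpa using hp.add hq
  | mul_X p i hp => simpa using hp.mul (contDiff_piLp_apply (p := 2))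

lemma hasFDerivAt_eval (p : MvPolynomial (∀ k, Fin (n k)) ℝ) (A : Tensor n) :
    HasFDerivAt (fun B : Tensor n => MvPolynomial.eval B.ofLp p) (innerSL ℝ (polyGrad A p)) A := by
  induction p using MvPolynomial.induction_on with
  | C a =>
    have h : polyGrad A (MvPolynomial.C a) = 0 := by ext i; simp
    simpa [h] using hasFDerivAt_const a A
  | add p q hp hq =>
    simp only [map_add]
    exact hp.fun_add hq
  | mul_X p i hp =>
    have h : HasFDerivAt (fun B : Tensor n => B i)
        (PiLp.proj 2 (fun _ : ∀ k, Fin (n k) => ℝ) i : Tensor n →L[ℝ] ℝ) A :=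
      (PiLp.proj 2 (fun _ : ∀ k, Fin (n k) => ℝ) i : Tensor n →L[ℝ] ℝ).hasFDerivAt
    simp only [map_mul, MvPolynomial.eval_X]
    refine (hp.mul h).congr_fderiv ?_
    ext v
    simp only [add_apply, smul_apply, PiLp.proj_apply,
      innerSL_apply_apply, PiLp.inner_apply, polyGrad_apply, smul_eq_mul, Derivation.leibniz,
      MvPolynomial.pderiv_X, RCLike.inner_apply, conj_trivial, map_add, map_mul,
      MvPolynomial.eval_X, mul_add, Finset.sum_add_distrib, Finset.mul_sum]
    congr 1
    · rw [Finset.sum_eq_single i]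
      · simp; ring
      · intro j _ hj
        simp [hj.symm]
      · simp
    · refine Finset.sum_congr rfl fun j _ => ?_
      ring

lemma mem_vanIdeal {V : Set (Tensor n)} {p : MvPolynomial (∀ k, Fin (n k)) ℝ} :
    p ∈ vanIdeal V ↔ ∀ B ∈ V, MvPolynomial.eval B.ofLp p = 0 := by
  simp [vanIdeal, MvPolynomial.mem_vanishingIdeal_iff, MvPolynomial.aeval_eq_eval]

lemma mem_zariskiClosure {V : Set (Tensor n)} {B : Tensor n} :
    B ∈ zariskiClosure V ↔ ∀ p ∈ vanIdeal V, MvPolynomial.eval B.ofLp p = 0 := by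
  simp [zariskiClosure, MvPolynomial.mem_zeroLocus_iff, MvPolynomial.aeval_eq_eval]

lemma subset_zariskiClosure (V : Set (Tensor n)) : V ⊆ zariskiClosure V := fun B hB =>
  mem_zariskiClosure.2 fun _ hp => mem_vanIdeal.1 hp B hB

lemma mem_zariskiTangent {I : Ideal (MvPolynomial (∀ k, Fin (n k)) ℝ)} {A v : Tensor n} :
    v ∈ zariskiTangent I A ↔ ∀ p ∈ I, inner ℝ (polyGrad A p) v = 0 := by
  refine forall₂_congr fun p _ => ?_
  simp [PiLp.inner_apply, mul_comm]

/-- The variety of an ideal `I` is flattened near a point `A` by a change of coordinates `H` whose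
derivative at `A` is the identity: on the variety, `H` is the orthogonal projection to the Zariski
tangent space at `A`, and on the Zariski tangent spaces of the variety the derivative of `H` is
that projection. It is enough to add to the projection the polynomials `p_j ∈ I` whose
gradients at `A` form an orthonormal basis of the normal space, times these gradients. -/
lemma exists_flattening (I : Ideal (MvPolynomial (∀ k, Fin (n k)) ℝ)) (A : Tensor n) :
    ∃ H : Tensor n → Tensor n, ContDiff ℝ ω H ∧ HasFDerivAt H (ContinuousLinearMap.id ℝ _) A ∧
      (∀ B : Tensor n, (∀ p ∈ I, MvPolynomial.eval B.ofLp p = 0) →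
        H B = (zariskiTangent I A).starProjection B) ∧
      ∀ B v, v ∈ zariskiTangent I B → fderiv ℝ H B v = (zariskiTangent I A).starProjection v := by
  set T := zariskiTangent I A with hT
  let D : Submodule ℝ (Tensor n) := (I.restrictScalars ℝ).map (polyGrad A)
  have hDT : Dᗮ = T := by
    ext v
    rw [hT, mem_zariskiTangent, Submodule.mem_orthogonal]
    constructor
    · exact fun h p hp => h _ (Submodule.mem_map_of_mem hp)
    · rintro h _ ⟨p, hp, rfl⟩
      exact h p hp
  have hTD : Tᗮ = D := by rw [← hDT, Submodule.orthogonal_orthogonal]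
  let u := stdOrthonormalBasis ℝ D
  have hu : ∀ j, ∃ p ∈ I, polyGrad A p = u j := fun j => (u j).2
  choose p hpI hp using hu
  let H : Tensor n → Tensor n := fun B =>
    T.starProjection B + ∑ j, MvPolynomial.eval B.ofLp (p j) • (u j : Tensor n)
  have hd : ∀ B, HasFDerivAt H (T.starProjection +
      ∑ j, (innerSL ℝ (polyGrad B (p j))).smulRight (u j : Tensor n)) B := fun B =>
    T.starProjection.hasFDerivAt.add
      (HasFDerivAt.fun_sum fun j _ => (hasFDerivAt_eval (p j) B).smul_const _)
  refine ⟨H, ?_, (hd A).congr_fderiv ?_, ?_, ?_⟩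
  · exact (ContinuousLinearMap.contDiff _).add
      (ContDiff.sum fun j _ => (contDiff_eval (p j)).smul contDiff_const)
  · ext1 v
    have h1 : D.starProjection v = ∑ j, inner ℝ (u j : Tensor n) v • (u j : Tensor n) := by
      rw [Submodule.starProjection_apply, ← u.sum_repr (D.orthogonalProjectionOnto v)]
      simp [u.repr_apply_apply]
    have h2 : T.starProjection v + D.starProjection v = v := by
      rw [← hTD]
      exact Submodule.starProjection_add_starProjection_orthogonal v
    simp only [add_apply, sum_apply,
      ContinuousLinearMap.smulRight_apply, innerSL_apply_apply, hp, ContinuousLinearMap.id_apply]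
    rw [← h1, h2]
  · intro B hB
    simp [H, hB _ (hpI _)]
  · intro B v hv
    rw [(hd B).fderiv]
    simp [mem_zariskiTangent.1 hv _ (hpI _)]

/-- The dimension of the Zariski tangent space is upper semicontinuous. -/
lemma eventually_finrank_zariskiTangent_le (I : Ideal (MvPolynomial (∀ k, Fin (n k)) ℝ))
    (A : Tensor n) : ∀ᶠ B in 𝓝 A,
      Module.finrank ℝ (zariskiTangent I B) ≤ Module.finrank ℝ (zariskiTangent I A) := by
  obtain ⟨H, hH, hHA, -, hHT⟩ := exists_flattening I A
  have h1 : Continuous (fderiv ℝ H) := hH.continuous_fderiv (by simp)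
  have h2 : ∀ᶠ B in 𝓝 A, Function.Injective (fderiv ℝ H B) :=
    h1.continuousAt.eventually (ContinuousLinearMap.isOpen_injective.mem_nhds (by
      rw [hHA.fderiv]
      exact Function.injective_id))
  filter_upwards [h2] with B hB
  refine LinearMap.finrank_le_finrank_of_injective
    (f := (((zariskiTangent I A).orthogonalProjectionOnto).toLinearMap ∘ₗ
      (zariskiTangent I B).subtype)) ?_
  intro v w hvw
  refine Subtype.ext (hB ?_)
  rw [hHT B v v.2, hHT B w w.2]
  exact congrArg Subtype.val hvw

/-- The tangent vectors of a smooth map into the variety of an ideal are Zariski tangent vectors. -/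
lemma fderiv_mem_zariskiTangent {I : Ideal (MvPolynomial (∀ k, Fin (n k)) ℝ)}
    {V : Type*} [NormedAddCommGroup V] [NormedSpace ℝ V] {f : V → Tensor n}
    (hfI : ∀ x, ∀ p ∈ I, MvPolynomial.eval (f x).ofLp p = 0) {x : V}
    (hf : DifferentiableAt ℝ f x) (v : V) : fderiv ℝ f x v ∈ zariskiTangent I (f x) := by
  rw [mem_zariskiTangent]
  intro p hp
  have h1 := (hasFDerivAt_eval p (f x)).comp x hf.hasFDerivAt
  have h2 : (fun B : Tensor n => MvPolynomial.eval B.ofLp p) ∘ f = fun _ => 0 :=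
    funext fun y => hfI y p hp
  rw [h2] at h1
  have := h1.unique (hasFDerivAt_const 0 x)
  simpa using DFunLike.congr_fun this v

/-- A smooth map into the variety of an ideal, which is immersive at `x`, covers a neighbourhood of
its image point in the variety, if the Zariski tangent space there is not larger than the
source. -/
lemma eventually_mem_image_of_immersion {I : Ideal (MvPolynomial (∀ k, Fin (n k)) ℝ)}
    {V : Type*} [NormedAddCommGroup V] [NormedSpace ℝ V] [FiniteDimensional ℝ V]
    {f : V → Tensor n} (hf : ContDiff ℝ ω f)
    (hfI : ∀ x, ∀ p ∈ I, MvPolynomial.eval (f x).ofLp p = 0) {x : V}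
    (hx : Function.Injective (fderiv ℝ f x))
    (hT : Module.finrank ℝ (zariskiTangent I (f x)) = Module.finrank ℝ V)
    {U : Set V} (hU : U ∈ 𝓝 x) :
    ∀ᶠ B in 𝓝 (f x), (∀ p ∈ I, MvPolynomial.eval B.ofLp p = 0) → B ∈ f '' U := by
  set T := zariskiTangent I (f x) with hTdef
  obtain ⟨H, hH, hHA, hHI, -⟩ := exists_flattening I (f x)
  have hfd : HasStrictFDerivAt f (fderiv ℝ f x) x :=
    hf.contDiffAt.hasStrictFDerivAt (by simp)
  have hrange : ∀ v, fderiv ℝ f x v ∈ T :=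
    fderiv_mem_zariskiTangent hfI hfd.differentiableAt
  let Q : Tensor n →L[ℝ] T := T.orthogonalProjectionOnto
  have hsurj : (Q ∘L fderiv ℝ f x).range = ⊤ := by
    rw [LinearMap.range_eq_top]
    have hinj : Function.Injective (Q ∘L fderiv ℝ f x) := by
      intro v w hvw
      refine hx ?_
      have h1 : ∀ v, (Q (fderiv ℝ f x v) : Tensor n) = fderiv ℝ f x v := fun v =>
        Submodule.starProjection_eq_self_iff.2 (hrange v)
      rw [← h1 v, ← h1 w]
      exact congrArg Subtype.val hvw
    exact (LinearMap.injective_iff_surjective_of_finrank_eq_finrank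
      (f := (Q ∘L fderiv ℝ f x).toLinearMap) hT.symm).1 hinj
  have hQf : HasStrictFDerivAt (fun y => Q (f y)) (Q ∘L fderiv ℝ f x) x :=
    Q.hasStrictFDerivAt.comp x hfd
  have hmap := hQf.map_nhds_eq_of_surj hsurj
  have hHs : HasStrictFDerivAt H
      ((ContinuousLinearEquiv.refl ℝ (Tensor n) : Tensor n →L[ℝ] Tensor n)) (f x) :=
    hH.contDiffAt.hasStrictFDerivAt' hHA (by simp)
  have hinv := hHs.eventually_left_inverse
  have hU' : U ∩ {y | hHs.localInverse _ _ _ (H (f y)) = f y} ∈ 𝓝 x :=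
    inter_mem hU (hfd.continuousAt.eventually hinv)
  have h3 : (fun y => Q (f y)) '' (U ∩ {y | hHs.localInverse _ _ _ (H (f y)) = f y}) ∈
      𝓝 (Q (f x)) := by
    rw [← hmap]
    exact image_mem_map hU'
  -- A point `B` of the variety near `f x` has the same projection as some `f y` with `y` near `x`,
  -- hence the same image under `H`, and `H` is injective near `f x`.
  filter_upwards [Q.continuous.continuousAt.eventually h3, hinv] with B ⟨y, ⟨hy1, hy2⟩, hy3⟩ hB hBI
  refine ⟨y, hy1, ?_⟩
  have h4 : H (f y) = H B := by
    rw [hHI _ (hfI y), hHI _ hBI]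
    exact congrArg Subtype.val hy3
  rw [← hB, ← h4]
  exact hy2.symm

end Polynomial

end CPD

/-! ### Generic identifiability and sums of rank-one tensors -/

namespace CPD

variable {d : ℕ} {n : Fin d → ℕ} {r m : ℕ} [∀ k, NeZero (n k)]

lemma dense_corner : Dense {b : Fin r → ∀ k, Fin (n k) → ℝ | ∀ i k, b i k 0 ≠ 0} := by
  have h1 : ContDiff ℝ ω fun b : Fin r → ∀ k, Fin (n k) → ℝ => ∏ i, ∏ k, b i k 0 :=
    contDiff_prod fun i _ => contDiff_prod fun k _ =>
      contDiff_pi.1 (contDiff_pi.1 (contDiff_pi.1 contDiff_id i) k) 0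
  refine (h1.dense_ne_zero (x₀ := fun _ _ _ => 1) (by simp)).mono fun b hb i k => ?_
  exact Finset.prod_ne_zero_iff.1 (Finset.prod_ne_zero_iff.1 hb i (Finset.mem_univ i)) k
    (Finset.mem_univ k)

lemma isOpen_corner_factors :
    IsOpen {b : Fin r → ∀ k, Fin (n k) → ℝ | ∀ i k, b i k 0 ≠ 0} := by
  simp only [ofPred_forall]
  exact isOpen_iInter_of_finite fun i => isOpen_iInter_of_finite fun k =>
    isOpen_ne_fun (by fun_prop) continuous_const

section

variable {k₀ : Fin d} (e : Fin r × ChartIndex n k₀ ≃ Fin m)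

/-- The sum of the rank-one tensors with given coordinates. -/
noncomputable def chartSum (x : EuclideanSpace ℝ (Fin m)) : Tensor n := addMap (chartMap e x)

lemma contDiff_chartSum : ContDiff ℝ ω (chartSum e) := contDiff_addMap.comp (contDiff_chartMap e)

lemma chartSum_mem_sigma (x : EuclideanSpace ℝ (Fin m)) : chartSum e x ∈ sigma n r :=
  addMap_elementaryTuple_mem_sigma _

/-- The sums of rank-one tensors with nonzero corner entries are dense in `σ_r`, so the chart
detects its ideal. -/
lemma mem_vanIdeal_sigma_iff {p : MvPolynomial (∀ k, Fin (n k)) ℝ} :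
    p ∈ vanIdeal (sigma n r) ↔ ∀ x, MvPolynomial.eval (chartSum e x).ofLp p = 0 := by
  rw [mem_vanIdeal]
  refine ⟨fun h x => h _ (chartSum_mem_sigma e x), ?_⟩
  rintro h _ ⟨b, rfl⟩
  have h1 : Continuous fun b : Fin r → ∀ k, Fin (n k) → ℝ =>
      MvPolynomial.eval (addMap (elementaryTuple b)).ofLp p :=
    (contDiff_eval p).continuous.comp (continuous_addMap.comp contDiff_elementaryTuple.continuous)
  have h2 := h1.ext_on dense_corner (continuous_const (y := (0 : ℝ))) fun b hb => by
    have := h (chartInv e (elementaryTuple b))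
    rwa [chartSum, chartMap_chartInv_elementaryTuple e hb] at this
  exact congrFun h2 b

lemma eval_chartSum_eq_zero (x : EuclideanSpace ℝ (Fin m)) (p : MvPolynomial (∀ k, Fin (n k)) ℝ)
    (hp : p ∈ vanIdeal (sigma n r)) : MvPolynomial.eval (chartSum e x).ofLp p = 0 :=
  (mem_vanIdeal_sigma_iff e).1 hp x

/-- Substitution of the chart into a polynomial in the entries of a tensor. -/
noncomputable def chartAlgHom :
    MvPolynomial (∀ k, Fin (n k)) ℝ →ₐ[ℝ] MvPolynomial (Fin m) ℝ :=
  MvPolynomial.aeval fun idx => ∑ i, ∏ k,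
    if h : idx k ≠ 0 ∨ k = k₀ then MvPolynomial.X (e (i, ⟨⟨k, idx k⟩, h⟩)) else 1

lemma eval_chartAlgHom (p : MvPolynomial (∀ k, Fin (n k)) ℝ) (x : EuclideanSpace ℝ (Fin m)) :
    MvPolynomial.eval x.ofLp (chartAlgHom e p) = MvPolynomial.eval (chartSum e x).ofLp p := by
  induction p using MvPolynomial.induction_on with
  | C a => simp [chartAlgHom]
  | add p q hp hq => simp [hp, hq]
  | mul_X p idx hp =>
    rw [map_mul, map_mul, map_mul, hp, MvPolynomial.eval_X]
    congr 1
    simp only [chartAlgHom, MvPolynomial.aeval_X, map_sum, map_prod, chartSum, addMap_apply]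
    refine Finset.sum_congr rfl fun i _ => Finset.prod_congr rfl fun k _ => ?_
    unfold chartFactors
    split_ifs <;> simp

include e in
/-- The variety `σ_r` has dimension at most the number of coordinates. -/
lemma trdeg_sigma_le :
    Algebra.trdeg ℝ (MvPolynomial (∀ k, Fin (n k)) ℝ ⧸ vanIdeal (sigma n r)) ≤ m := by
  have hker : ∀ p, chartAlgHom e p = 0 ↔ p ∈ vanIdeal (sigma n r) := by
    intro p
    rw [mem_vanIdeal_sigma_iff e]
    refine ⟨fun h x => by rw [← eval_chartAlgHom, h, map_zero], fun h => ?_⟩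
    refine MvPolynomial.funext fun x => ?_
    have := eval_chartAlgHom e p (WithLp.toLp 2 x)
    rw [h] at this
    simpa using this
  let A : (MvPolynomial (∀ k, Fin (n k)) ℝ ⧸ vanIdeal (sigma n r)) →ₐ[ℝ]
      MvPolynomial (Fin m) ℝ :=
    Ideal.Quotient.liftₐ _ (chartAlgHom e) fun p hp => (hker p).2 hp
  have hA : Function.Injective A := by
    rw [injective_iff_map_eq_zero]
    intro p
    obtain ⟨p, rfl⟩ := Ideal.Quotient.mk_surjective p
    intro hp
    exact Ideal.Quotient.eq_zero_iff_mem.2 ((hker p).1 hp)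
  refine (trdeg_le_of_injective A hA).trans ?_
  rw [MvPolynomial.trdeg_of_isDomain]
  simp

omit [∀ k, NeZero (n k)] in
/-- Generic identifiability holds off the zeros of a single polynomial that does not vanish on
`σ_r`. -/
lemma GenericallyIdentifiable.exists_polynomial (hid : GenericallyIdentifiable n r) :
    ∃ q ∉ vanIdeal (sigma n r), ∀ B ∈ sigma n r, MvPolynomial.eval B.ofLp q ≠ 0 →
      IsIdentifiable r B := by
  obtain ⟨Z, hZ, hZσ, h⟩ := hid
  obtain ⟨B₀, hB₀, hB₀Z⟩ := exists_of_ssubset hZσ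
  rw [← hZ, mem_zariskiClosure] at hB₀Z
  push Not at hB₀Z
  obtain ⟨q, hqZ, hq⟩ := hB₀Z
  refine ⟨q, fun hqσ => hq (mem_zariskiClosure.1 hB₀ q hqσ), fun B hB hBq => h B hB fun hBZ => ?_⟩
  exact hBq (mem_vanIdeal.1 hqZ B hBZ)

/-- The tensors at which a polynomial does not vanish have dense preimage in the chart. -/
lemma dense_eval_chartSum {q : MvPolynomial (∀ k, Fin (n k)) ℝ} (hq : q ∉ vanIdeal (sigma n r)) :
    Dense {x | MvPolynomial.eval (chartSum e x).ofLp q ≠ 0} := by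
  rw [mem_vanIdeal_sigma_iff e] at hq
  push Not at hq
  obtain ⟨x₀, hx₀⟩ := hq
  exact ((contDiff_eval q).comp (contDiff_chartSum e)).dense_ne_zero hx₀

lemma dense_eval_elementaryTuple {q : MvPolynomial (∀ k, Fin (n k)) ℝ}
    (hq : q ∉ vanIdeal (sigma n r)) :
    Dense {b : Fin r → ∀ k, Fin (n k) → ℝ | (∀ i k, b i k 0 ≠ 0) ∧
      MvPolynomial.eval (addMap (elementaryTuple b)).ofLp q ≠ 0} := by
  rw [mem_vanIdeal] at hq
  push Not at hq
  obtain ⟨_, ⟨b₀, rfl⟩, hb₀⟩ := hq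
  exact dense_corner.inter_of_isOpen_left
    (((contDiff_eval q).comp (contDiff_addMap.comp contDiff_elementaryTuple)).dense_ne_zero
      (x₀ := b₀) hb₀) isOpen_corner_factors

/-- If `x` is a point of the chart at which the addition map is an immersion into the variety with
Zariski tangent space of the same dimension, then a decomposition of the sum into at most `r`
elementary tensors coincides with the given one. Indeed, both decompositions are limits of
decompositions of generic tensors near the sum: these tensors are sums of tuples near the given
one, because the variety is covered by the chart, and they are identifiable. -/
lemma exists_perm_eq_elementaryTuple {q : MvPolynomial (∀ k, Fin (n k)) ℝ}
    (hq : q ∉ vanIdeal (sigma n r))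
    (hid : ∀ B ∈ sigma n r, MvPolynomial.eval B.ofLp q ≠ 0 → IsIdentifiable r B)
    {x : EuclideanSpace ℝ (Fin m)} (hx0 : ∀ i, chartMap e x i 0 ≠ 0)
    (hx : Function.Injective (fderiv ℝ (chartSum e) x))
    (hT : Module.finrank ℝ (zariskiTangent (vanIdeal (sigma n r)) (chartSum e x)) = m)
    {b : Fin r → ∀ k, Fin (n k) → ℝ} (hb : addMap (elementaryTuple b) = chartSum e x) :
    ∃ π, permTuple π (chartMap e x) = elementaryTuple b := by
  -- The pairs of decompositions that agree up to order form a closed set.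
  let C : Set (EuclideanSpace ℝ (Fin m) × (Fin r → ∀ k, Fin (n k) → ℝ)) :=
    {y | ∃ π, permTuple π (chartMap e y.1) = elementaryTuple y.2}
  have hC : IsClosed C := by
    have : C = ⋃ π : Equiv.Perm (Fin r), {y | permTuple π (chartMap e y.1) =
      elementaryTuple y.2} := by ext; simp [C]
    rw [this]
    exact isClosed_iUnion_of_finite fun π => isClosed_eq
      ((isometry_permTuple π).continuous.comp
        ((contDiff_chartMap e).continuous.comp continuous_fst))
      (contDiff_elementaryTuple.continuous.comp continuous_snd)
  suffices h : (x, b) ∈ closure C by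
    rwa [hC.closure_eq] at h
  rw [mem_closure_iff_nhds]
  intro W hW
  obtain ⟨U, hU, V, hV, hUV⟩ := mem_nhds_prod_iff.1 hW
  have hU' : U ∩ {x | ∀ i, chartMap e x i 0 ≠ 0} ∈ 𝓝 x :=
    inter_mem hU ((isOpen_corner e).mem_nhds hx0)
  have h1 := eventually_mem_image_of_immersion (contDiff_chartSum e) (eval_chartSum_eq_zero e) hx
    (by rw [hT]; simp) hU'
  rw [← hb] at h1
  have h2 := (continuous_addMap.comp
    (contDiff_elementaryTuple (n := n) (r := r)).continuous).continuousAt.eventually h1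
  obtain ⟨b', ⟨hb'0, hb'q⟩, hb'⟩ :=
    (dense_eval_elementaryTuple hq).inter_nhds_nonempty (inter_mem hV h2)
  have hσ := addMap_elementaryTuple_mem_sigma b'
  obtain ⟨x', ⟨hx'U, hx'0⟩, hx'⟩ := hb'.2 (fun p hp => mem_vanIdeal.1 hp _ hσ)
  have hseg : elementaryTuple b' ∈ segreTuples n r := by
    rw [← chartMap_chartInv_elementaryTuple e hb'0]
    refine chartMap_mem_segreTuples e fun i => ?_
    rw [chartMap_chartInv_elementaryTuple e hb'0]
    exact (Finset.prod_ne_zero_iff.2 fun k _ => hb'0 i k : ∏ k, b' i k 0 ≠ 0)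
  obtain ⟨π, hπ⟩ := (hid _ hσ hb'q).2 _ (chartMap_mem_segreTuples e hx'0) _ hseg hx' rfl
  exact ⟨(x', b'), hUV ⟨hx'U, hb'.1⟩, π, hπ⟩

/-- If the addition map is, at a point of the chart, an immersion into the variety with Zariski
tangent space of the same dimension, then the sum is identifiable. Its rank is not smaller than `r`,
since a shorter decomposition could be padded by zeros. -/
lemma isIdentifiable_chartSum {q : MvPolynomial (∀ k, Fin (n k)) ℝ}
    (hq : q ∉ vanIdeal (sigma n r))
    (hid : ∀ B ∈ sigma n r, MvPolynomial.eval B.ofLp q ≠ 0 → IsIdentifiable r B)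
    {x : EuclideanSpace ℝ (Fin m)} (hx0 : ∀ i, chartMap e x i 0 ≠ 0)
    (hx : Function.Injective (fderiv ℝ (chartSum e) x))
    (hT : Module.finrank ℝ (zariskiTangent (vanIdeal (sigma n r)) (chartSum e x)) = m) :
    IsIdentifiable r (chartSum e x) := by
  have hseg := chartMap_mem_segreTuples e hx0
  have key := fun b => exists_perm_eq_elementaryTuple (b := b) e hq hid hx0 hx hT
  constructor
  · refine le_antisymm (Nat.sInf_le ⟨chartMap e x, hseg, rfl⟩)
      (le_csInf ⟨r, chartMap e x, hseg, rfl⟩ ?_)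
    rintro s ⟨a, ha, hax⟩
    by_contra! hs
    obtain ⟨f, rfl⟩ := exists_elementaryTuple ha
    let b : Fin r → ∀ k, Fin (n k) → ℝ := fun i => if h : (i : ℕ) < s then f ⟨i, h⟩ else 0
    -- There is a factor with index `k₀`, so the zero factors have product zero.
    have helem0 : elementary (0 : ∀ k, Fin (n k) → ℝ) = 0 := by
      ext idx
      exact Finset.prod_eq_zero (Finset.mem_univ k₀) rfl
    have hbs : addMap (elementaryTuple b) = chartSum e x := by
      rw [← hax, addMap_elementaryTuple, addMap_elementaryTuple]
      let G : ℕ → Tensor n := fun i => if h : i < s then elementary (f ⟨i, h⟩) else 0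
      have h1 : ∀ i : Fin r, elementary (b i) = G i := by
        intro i
        simp only [b, G]
        split_ifs
        · rfl
        · exact helem0
      have h2 : ∀ i : Fin s, elementary (f i) = G i := fun i => by simp [G]
      simp_rw [h1, h2]
      rw [Fin.sum_univ_eq_sum_range, Fin.sum_univ_eq_sum_range]
      refine (Finset.sum_subset (Finset.range_mono hs.le) fun i _ hi => ?_).symm
      exact dif_neg (by simpa using hi)
    obtain ⟨π, hπ⟩ := key b hbs
    have h1 := congrFun (congrArg WithLp.ofLp hπ) ⟨s, hs⟩
    have h2 : b ⟨s, hs⟩ = 0 := dif_neg (lt_irrefl s)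
    rw [elementaryTuple_apply, h2, helem0] at h1
    exact (permTuple_mem_segreTuples π hseg ⟨s, hs⟩).1 h1
  · intro a ha b hb hax hbx
    obtain ⟨f, rfl⟩ := exists_elementaryTuple ha
    obtain ⟨g, rfl⟩ := exists_elementaryTuple hb
    obtain ⟨π, hπ⟩ := key f hax
    obtain ⟨ρ, hρ⟩ := key g hbx
    refine ⟨ρ * π⁻¹, ?_⟩
    rw [permTuple_mul, ← hπ, permTuple_inv_left, hρ]

end

end CPD

/-! ### The condition number in the chart -/

section Calculus

variable {V F G : Type*} [NormedAddCommGroup V] [NormedSpace ℝ V] [NormedAddCommGroup F]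
  [NormedSpace ℝ F] [NormedAddCommGroup G] [NormedSpace ℝ G]

/-- A comparison of increments of two maps near a point passes to their derivatives. -/
lemma norm_fderiv_le_of_eventually {φ : V → F} {f : V → G} {φ' : V →L[ℝ] F} {f' : V →L[ℝ] G}
    {x : V} (hφ : HasFDerivAt φ φ' x) (hf : HasFDerivAt f f' x) {C : ℝ}
    (h : ∀ᶠ y in 𝓝 x, ‖φ y - φ x‖ ≤ C * ‖f y - f x‖) (v : V) : ‖φ' v‖ ≤ C * ‖f' v‖ := by
  have hc : Tendsto (fun k : ℕ => ‖(k : ℝ)‖) atTop atTop := by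
    simpa using tendsto_natCast_atTop_atTop (R := ℝ)
  have h1 := (hφ.lim v hc).norm
  have h2 := ((hf.lim v hc).norm).const_mul C
  refine le_of_tendsto_of_tendsto h1 h2 ?_
  have h3 : Tendsto (fun k : ℕ => x + (k : ℝ)⁻¹ • v) atTop (𝓝 x) := by
    have : Tendsto (fun k : ℕ => (k : ℝ)⁻¹ • v) atTop (𝓝 ((0 : ℝ) • v)) :=
      (tendsto_inv_atTop_nhds_zero_nat (𝕜 := ℝ)).smul_const v
    simpa using this.const_add x
  filter_upwards [h3.eventually h] with k hk
  rw [norm_smul, norm_smul, mul_left_comm]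
  exact mul_le_mul_of_nonneg_left hk (norm_nonneg _)

/-- Near a point where its derivative is injective, a continuously differentiable map has a
Lipschitz inverse. -/
lemma eventually_norm_sub_le_of_injective [FiniteDimensional ℝ V] {f : V → G} {f' : V →L[ℝ] G}
    {x : V} (hf : HasStrictFDerivAt f f' x) (hinj : Function.Injective f') :
    ∃ K : ℝ, 0 ≤ K ∧ ∃ U ∈ 𝓝 x, ∀ y ∈ U, ∀ z ∈ U, ‖y - z‖ ≤ K * ‖f y - f z‖ := by
  obtain ⟨K, hK, hKf⟩ := f'.toLinearMap.exists_antilipschitzWith (LinearMap.ker_eq_bot.2 hinj)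
  have hK0 : (0 : ℝ) < K := hK
  have hKv : ∀ v, ‖v‖ ≤ K * ‖f' v‖ := fun v => by simpa using hKf.le_mul_norm_sub v 0
  have h1 := hf.isLittleO.def (c := (2 * K : ℝ)⁻¹) (by positivity)
  obtain ⟨U₁, hU₁, U₂, hU₂, hU⟩ := mem_nhds_prod_iff.1 h1
  refine ⟨2 * K, by positivity, U₁ ∩ U₂, inter_mem hU₁ hU₂, fun y hy z hz => ?_⟩
  have h2 : ‖f y - f z - f' (y - z)‖ ≤ (2 * K : ℝ)⁻¹ * ‖y - z‖ := hU (mk_mem_prod hy.1 hz.2)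
  have h3 : ‖f' (y - z)‖ ≤ ‖f y - f z‖ + ‖f y - f z - f' (y - z)‖ := by
    have := norm_sub_le (f y - f z) (f y - f z - f' (y - z))
    rwa [sub_sub_cancel] at this
  have h4 := hKv (y - z)
  have h5 : K * ‖f' (y - z)‖ ≤ K * ‖f y - f z‖ + K * ((2 * K : ℝ)⁻¹ * ‖y - z‖) := by
    rw [← mul_add]
    exact mul_le_mul_of_nonneg_left (h3.trans (add_le_add_right h2 _)) hK0.le
  have h6 : K * ((2 * K : ℝ)⁻¹ * ‖y - z‖) = ‖y - z‖ / 2 := by field_simp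
  linarith

/-- If the derivative of `φ` at `x` is bounded by `C` times that of `f`, and the latter is
injective, then the increments of `φ` at `x` are bounded by nearly `C` times those of `f`. -/
lemma eventually_norm_sub_le_of_fderiv [FiniteDimensional ℝ V] {φ : V → F} {f : V → G}
    {φ' : V →L[ℝ] F} {f' : V →L[ℝ] G} {x : V} (hφ : HasFDerivAt φ φ' x)
    (hf : HasStrictFDerivAt f f' x) (hinj : Function.Injective f') {C C' : ℝ} (hC : 0 ≤ C)
    (hCC' : C < C') (h : ∀ v, ‖φ' v‖ ≤ C * ‖f' v‖) :
    ∀ᶠ y in 𝓝 x, ‖φ y - φ x‖ ≤ C' * ‖f y - f x‖ := by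
  obtain ⟨K, hK, U, hU, hUK⟩ := eventually_norm_sub_le_of_injective hf hinj
  -- The errors `δ ‖y - x‖` of both linearizations cost at most `(C + 1) K δ ‖f y - f x‖`.
  set δ : ℝ := (C' - C) / ((C + 1) * K + 1) with hδ
  have hden : 0 < (C + 1) * K + 1 := by positivity
  have hδ0 : 0 < δ := div_pos (sub_pos.2 hCC') hden
  have hδK : (C + 1) * K * δ ≤ C' - C := by
    have : ((C + 1) * K + 1) * δ = C' - C := by rw [hδ]; field_simp
    nlinarith
  filter_upwards [hU, hφ.isLittleO.def hδ0, hf.hasFDerivAt.isLittleO.def hδ0] with y hy h1 h2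
  have h3 := hUK y hy x (mem_of_mem_nhds hU)
  have h4 : ‖φ y - φ x‖ ≤ ‖φ' (y - x)‖ + δ * ‖y - x‖ := by
    have := norm_add_le (φ' (y - x)) (φ y - φ x - φ' (y - x))
    rw [add_sub_cancel] at this
    linarith
  have h5 : ‖f' (y - x)‖ ≤ ‖f y - f x‖ + δ * ‖y - x‖ := by
    have := norm_sub_le (f y - f x) (f y - f x - f' (y - x))
    rw [sub_sub_cancel] at this
    linarith
  have h6 := mul_le_mul_of_nonneg_left h5 hC
  have h7 := mul_le_mul_of_nonneg_left h3 (show 0 ≤ (C + 1) * δ by positivity)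
  have h8 := mul_le_mul_of_nonneg_right hδK (norm_nonneg (f y - f x))
  have h9 := h (y - x)
  nlinarith

end Calculus

namespace CPD

variable {d : ℕ} {n : Fin d → ℕ} {r m : ℕ} [∀ k, NeZero (n k)]
  {k₀ : Fin d} (e : Fin r × ChartIndex n k₀ ≃ Fin m)

/-- The differential of the chart is injective, because the chart has a smooth left inverse. -/
lemma injective_fderiv_chartMap {x : EuclideanSpace ℝ (Fin m)}
    (hx0 : ∀ i, chartMap e x i 0 ≠ 0) : Function.Injective (fderiv ℝ (chartMap e) x) := by
  have h1 : HasFDerivAt (chartInv e ∘ chartMap e)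
      (fderiv ℝ (chartInv e) (chartMap e x) ∘L fderiv ℝ (chartMap e) x) x :=
    ((contDiffAt_chartInv e hx0).differentiableAt (by simp)).hasFDerivAt.comp x
      ((contDiff_chartMap e).differentiable (by simp) x).hasFDerivAt
  have h2 : chartInv e ∘ chartMap e =ᶠ[𝓝 x] id := by
    filter_upwards [(isOpen_corner e).mem_nhds hx0] with y hy
    exact chartInv_chartMap e hy
  have h3 := h1.unique ((hasFDerivAt_id x).congr_of_eventuallyEq h2)
  intro v w hvw
  have h4 := fun v => DFunLike.congr_fun h3 v
  simp only [ContinuousLinearMap.comp_apply, ContinuousLinearMap.id_apply] at h4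
  rw [← h4 v, ← h4 w, hvw]

lemma hasFDerivAt_chartMap (x : EuclideanSpace ℝ (Fin m)) :
    HasFDerivAt (chartMap e) (fderiv ℝ (chartMap e) x) x :=
  ((contDiff_chartMap e).differentiable (by simp) x).hasFDerivAt

lemma hasStrictFDerivAt_chartSum (x : EuclideanSpace ℝ (Fin m)) :
    HasStrictFDerivAt (chartSum e) (fderiv ℝ (chartSum e) x) x :=
  (contDiff_chartSum e).contDiffAt.hasStrictFDerivAt (by simp)

/-- A bound for the condition number bounds the differential of the chart by that of the sum. It
suffices to compare increments at points whose sums are generic, and these are dense. -/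
lemma norm_fderiv_chartMap_le_of_kappa_lt {q : MvPolynomial (∀ k, Fin (n k)) ℝ}
    (hq : q ∉ vanIdeal (sigma n r))
    (hid : ∀ B ∈ sigma n r, MvPolynomial.eval B.ofLp q ≠ 0 → IsIdentifiable r B)
    {x : EuclideanSpace ℝ (Fin m)} (hx0 : ∀ i, chartMap e x i 0 ≠ 0) {C : NNReal}
    (hC : kappa (chartMap e x) < C) (v : EuclideanSpace ℝ (Fin m)) :
    ‖fderiv ℝ (chartMap e) x v‖ ≤ C * ‖fderiv ℝ (chartSum e) x v‖ := by
  refine norm_fderiv_le_of_eventually (hasFDerivAt_chartMap e x)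
    (hasStrictFDerivAt_chartSum e x).hasFDerivAt ?_ v
  unfold kappa at hC
  simp only [iInf_lt_iff] at hC
  obtain ⟨U, ψ, hψ, ε, hε, hlt⟩ := hC
  have h1 : Tendsto (chartMap e) (𝓝 x) (𝓝[segreTuples n r] (chartMap e x)) := by
    refine tendsto_nhdsWithin_iff.2 ⟨(contDiff_chartMap e).continuous.continuousAt, ?_⟩
    filter_upwards [(isOpen_corner e).mem_nhds hx0] with y hy using chartMap_mem_segreTuples e hy
  have h2 : ∀ᶠ y in 𝓝 x, ‖chartSum e x - chartSum e y‖ < ε := by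
    have : Continuous fun y => ‖chartSum e x - chartSum e y‖ :=
      (continuous_const.sub (contDiff_chartSum e).continuous).norm
    refine this.continuousAt.eventually_lt continuousAt_const ?_
    simpa using hε
  obtain ⟨W, hWs, hWo, hxW⟩ := mem_nhds_iff.1 (inter_mem (h1 hψ.mem_nhds) h2)
  have hxU : chartMap e x ∈ U := (hWs hxW).1
  have h3 : IsClosed {y | ‖chartMap e y - chartMap e x‖ ≤ C * ‖chartSum e y - chartSum e x‖} :=
    isClosed_le (((contDiff_chartMap e).continuous.sub continuous_const).norm)
      (continuous_const.mul ((contDiff_chartSum e).continuous.sub continuous_const).norm)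
  have h4 : W ⊆ closure (W ∩ {y | MvPolynomial.eval (chartSum e y).ofLp q ≠ 0}) :=
    (dense_eval_chartSum e hq).open_subset_closure_inter hWo
  refine eventually_of_mem (hWo.mem_nhds hxW) fun y hy =>
    closure_minimal ?_ h3 (h4 hy)
  rintro z ⟨hzW, hzq⟩
  obtain ⟨hzU, hzε⟩ := hWs hzW
  change ‖chartMap e z - chartMap e x‖ ≤ C * ‖chartSum e z - chartSum e x‖
  by_cases hzx : chartSum e z = chartSum e x
  · have : chartMap e z = chartMap e x := by
      rw [← hψ.left_inv _ hzU, ← hψ.left_inv _ hxU]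
      exact congrArg ψ hzx
    rw [this, sub_self, norm_zero]
    positivity
  · have h5 : ENNReal.ofReal (‖ψ (addMap (chartMap e x)) - ψ (chartSum e z)‖ /
        ‖addMap (chartMap e x) - chartSum e z‖) < C := by
      refine lt_of_le_of_lt ?_ hlt
      refine le_iSup₂_of_le (chartSum e z) ⟨mem_image_of_mem _ hzU,
        (hid _ (chartSum_mem_sigma e z) hzq).1, hzx, hzε⟩ le_rfl
    rw [hψ.left_inv _ hxU, show ψ (chartSum e z) = chartMap e z from hψ.left_inv _ hzU] at h5
    have h6 : ‖chartMap e x - chartMap e z‖ / ‖chartSum e x - chartSum e z‖ ≤ C :=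
      (ENNReal.ofReal_le_iff_le_toReal ENNReal.coe_ne_top).1 h5.le
    have h7 : 0 < ‖chartSum e x - chartSum e z‖ := norm_pos_iff.2 (sub_ne_zero.2 (Ne.symm hzx))
    rw [norm_sub_rev, norm_sub_rev (chartSum e z)]
    exact (div_le_iff₀ h7).1 h6

/-- A kernel vector of the differential of the sum would also be in the kernel of the differential
of the chart. -/
lemma injective_fderiv_chartSum_of_kappa_ne_top {q : MvPolynomial (∀ k, Fin (n k)) ℝ}
    (hq : q ∉ vanIdeal (sigma n r))
    (hid : ∀ B ∈ sigma n r, MvPolynomial.eval B.ofLp q ≠ 0 → IsIdentifiable r B)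
    {x : EuclideanSpace ℝ (Fin m)} (hx0 : ∀ i, chartMap e x i 0 ≠ 0)
    (hκ : kappa (chartMap e x) ≠ ⊤) : Function.Injective (fderiv ℝ (chartSum e) x) := by
  obtain ⟨C, hC⟩ := ENNReal.lt_iff_exists_coe.1 (lt_top_iff_ne_top.2 hκ)
  have hC' : kappa (chartMap e x) < (C + 1 : NNReal) := by
    rw [hC.1]
    exact_mod_cast lt_add_one C
  rw [injective_iff_map_eq_zero]
  intro v hv
  have h1 := norm_fderiv_chartMap_le_of_kappa_lt e hq hid hx0 hC' v
  rw [hv, norm_zero, mul_zero, norm_le_zero_iff] at h1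
  exact (injective_iff_map_eq_zero _).1 (injective_fderiv_chartMap e hx0) v h1

/-- The sum has a Lipschitz local inverse near a point where it is immersive, and the difference
quotients in the condition number are difference quotients of the chart over those of the sum. -/
lemma kappa_chartMap_le {x : EuclideanSpace ℝ (Fin m)} (hx0 : ∀ i, chartMap e x i 0 ≠ 0)
    (hx : Function.Injective (fderiv ℝ (chartSum e) x)) {C C' : ℝ} (hC : 0 ≤ C) (hCC' : C < C')
    (h : ∀ v, ‖fderiv ℝ (chartMap e) x v‖ ≤ C * ‖fderiv ℝ (chartSum e) x v‖) :
    kappa (chartMap e x) ≤ ENNReal.ofReal C' := by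
  have hf := hasStrictFDerivAt_chartSum e x
  obtain ⟨K, hK, V₁, hV₁, hVK⟩ := eventually_norm_sub_le_of_injective hf hx
  have h1 := eventually_norm_sub_le_of_fderiv (hasFDerivAt_chartMap e x) hf hx hC hCC' h
  obtain ⟨V, hVs, hVo, hxV⟩ := mem_nhds_iff.1
    (inter_mem (inter_mem hV₁ h1) ((isOpen_corner e).mem_nhds hx0))
  have hinj : InjOn (chartSum e) V := by
    intro y hy z hz hyz
    have := hVK y (hVs hy).1.1 z (hVs hz).1.1
    rw [hyz, sub_self, norm_zero, mul_zero, norm_le_zero_iff, sub_eq_zero] at this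
    exact this
  let s : Tensor n → EuclideanSpace ℝ (Fin m) := Function.invFunOn (chartSum e) V
  have hs : ∀ y ∈ V, s (chartSum e y) = y := fun y hy => hinj.leftInvOn_invFunOn hy
  let U : Set (Tuple n r) := chartMap e '' V
  have hU : IsLocalInverse (chartMap e x) U (fun B => chartMap e (s B)) := by
    constructor
    · rintro _ ⟨y, hy, rfl⟩
      exact chartMap_mem_segreTuples e (hVs hy).2
    · have h2 : ∀ᶠ a in 𝓝 (chartMap e x), chartInv e a ∈ V :=
        (contDiffAt_chartInv e hx0).continuousAt.eventually (by
          rw [chartInv_chartMap e hx0]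
          exact hVo.mem_nhds hxV)
      have h3 : ∀ᶠ a in 𝓝 (chartMap e x), ∀ i, a i 0 ≠ 0 := by
        rw [eventually_all]
        intro i
        have : Continuous fun a : Tuple n r => a i 0 := by fun_prop
        exact this.continuousAt.eventually_ne (hx0 i)
      filter_upwards [nhdsWithin_le_nhds h2, nhdsWithin_le_nhds h3, self_mem_nhdsWithin]
        with a ha1 ha2 ha3
      exact ⟨_, ha1, chartMap_chartInv e ha3 ha2⟩
    · rintro _ ⟨y, hy, rfl⟩
      exact congrArg _ (hs y hy)
    · refine (contDiff_chartMap e).continuous.comp_continuousOn ?_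
      have h4 : LipschitzOnWith ⟨K, hK⟩ s (addMap '' U) := by
        refine LipschitzOnWith.of_dist_le_mul ?_
        rintro _ ⟨_, ⟨y, hy, rfl⟩, rfl⟩ _ ⟨_, ⟨z, hz, rfl⟩, rfl⟩
        change dist (s (chartSum e y)) (s (chartSum e z)) ≤ K * dist (chartSum e y) (chartSum e z)
        rw [hs y hy, hs z hz, dist_eq_norm, dist_eq_norm]
        exact hVK y (hVs hy).1.1 z (hVs hz).1.1
      exact h4.continuousOn
  refine iInf_le_of_le U (iInf_le_of_le _ (iInf_le_of_le hU (iInf_le_of_le 1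
    (iInf_le_of_le one_pos ?_))))
  refine iSup₂_le ?_
  rintro _ ⟨⟨_, ⟨y, hy, rfl⟩, rfl⟩, -, -, -⟩
  refine ENNReal.ofReal_le_ofReal ?_
  change ‖chartMap e (s (chartSum e x)) - chartMap e (s (chartSum e y))‖ /
    ‖chartSum e x - chartSum e y‖ ≤ C'
  rw [hs x hxV, hs y hy, norm_sub_rev, norm_sub_rev (chartSum e x)]
  exact div_le_of_le_mul₀ (norm_nonneg _) (hC.trans hCC'.le) (hVs hy).1.2

lemma kappa_chartMap_ne_top {x : EuclideanSpace ℝ (Fin m)} (hx0 : ∀ i, chartMap e x i 0 ≠ 0)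
    (hx : Function.Injective (fderiv ℝ (chartSum e) x)) : kappa (chartMap e x) ≠ ⊤ := by
  obtain ⟨K, -, hKf⟩ := (fderiv ℝ (chartSum e) x).toLinearMap.exists_antilipschitzWith
    (LinearMap.ker_eq_bot.2 hx)
  refine ne_top_of_le_ne_top ENNReal.ofReal_ne_top (kappa_chartMap_le e hx0 hx
    (C := ‖fderiv ℝ (chartMap e) x‖ * K) (by positivity) (lt_add_one _) fun v => ?_)
  have h1 : ‖v‖ ≤ K * ‖fderiv ℝ (chartSum e) x v‖ := by simpa using hKf.le_mul_norm_sub v 0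
  rw [mul_assoc]
  exact ((fderiv ℝ (chartMap e) x).le_opNorm v).trans
    (mul_le_mul_of_nonneg_left h1 (norm_nonneg _))

/-- At a point where the sum is immersive, the condition number is the norm of the differential of
the local inverse of the addition map. -/
theorem kappa_chartMap {q : MvPolynomial (∀ k, Fin (n k)) ℝ}
    (hq : q ∉ vanIdeal (sigma n r))
    (hid : ∀ B ∈ sigma n r, MvPolynomial.eval B.ofLp q ≠ 0 → IsIdentifiable r B)
    {x : EuclideanSpace ℝ (Fin m)} (hx0 : ∀ i, chartMap e x i 0 ≠ 0)
    (hx : Function.Injective (fderiv ℝ (chartSum e) x)) :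
    kappa (chartMap e x) = ⨆ (v : EuclideanSpace ℝ (Fin m)) (_ : v ≠ 0),
      ENNReal.ofReal (‖fderiv ℝ (chartMap e) x v‖ / ‖fderiv ℝ (chartSum e) x v‖) := by
  have hpos : ∀ v ≠ 0, 0 < ‖fderiv ℝ (chartSum e) x v‖ := fun v hv =>
    norm_pos_iff.2 fun h => hv ((injective_iff_map_eq_zero _).1 hx v h)
  refine le_antisymm (le_of_forall_gt_imp_ge_of_dense fun c hc => ?_)
    (le_of_forall_gt_imp_ge_of_dense fun c hc => ?_)
  · induction c with
    | top => exact le_top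
    | coe c =>
    obtain ⟨C, hC1, hC2⟩ := ENNReal.lt_iff_exists_nnreal_btwn.1 hc
    have hCc : (C : ℝ) < c := by exact_mod_cast hC2
    refine (kappa_chartMap_le e hx0 hx C.2 hCc fun v => ?_).trans (by simp)
    by_cases hv : v = 0
    · simp [hv]
    · rw [← div_le_iff₀ (hpos v hv)]
      have := (le_iSup₂_of_le (f := fun (v : EuclideanSpace ℝ (Fin m)) (_ : v ≠ 0) =>
        ENNReal.ofReal (‖fderiv ℝ (chartMap e) x v‖ / ‖fderiv ℝ (chartSum e) x v‖)) v hv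
        le_rfl).trans hC1.le
      simpa using (ENNReal.ofReal_le_iff_le_toReal ENNReal.coe_ne_top).1 this
  · induction c with
    | top => exact le_top
    | coe c =>
    refine iSup₂_le fun v hv => ?_
    rw [ENNReal.ofReal_le_iff_le_toReal ENNReal.coe_ne_top, div_le_iff₀ (hpos v hv)]
    exact norm_fderiv_chartMap_le_of_kappa_lt e hq hid hx0 hc v

lemma le_finrank_zariskiTangent {x : EuclideanSpace ℝ (Fin m)}
    (hx : Function.Injective (fderiv ℝ (chartSum e) x)) :
    m ≤ Module.finrank ℝ (zariskiTangent (vanIdeal (sigma n r)) (chartSum e x)) := by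
  let D : EuclideanSpace ℝ (Fin m) →ₗ[ℝ]
      zariskiTangent (vanIdeal (sigma n r)) (chartSum e x) :=
    (fderiv ℝ (chartSum e) x).toLinearMap.codRestrict _
      (fderiv_mem_zariskiTangent (eval_chartSum_eq_zero e)
        (hasStrictFDerivAt_chartSum e x).differentiableAt)
  have hD : Function.Injective D := fun v w hvw => hx (congrArg Subtype.val hvw)
  simpa using LinearMap.finrank_le_finrank_of_injective hD

/-- The nice decompositions in the chart are described by conditions on the differential of the
addition map, on the Zariski tangent space and on the factors. -/
theorem isNice_chartMap_iff (hid : GenericallyIdentifiable n r) {x : EuclideanSpace ℝ (Fin m)} :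
    IsNice n r (chartMap e x) ↔ (∀ i, chartMap e x i 0 ≠ 0) ∧
      Function.Injective (fderiv ℝ (chartSum e) x) ∧ IsSmoothPoint (sigma n r) (chartSum e x) ∧
      Module.finrank ℝ (zariskiTangent (vanIdeal (sigma n r)) (chartSum e x)) = m ∧
      FactorsSGLP (chartFactors e x) := by
  obtain ⟨q, hq, hidq⟩ := hid.exists_polynomial
  constructor
  · intro h
    have hx0 : ∀ i, chartMap e x i 0 ≠ 0 := h.corner
    have hx := injective_fderiv_chartSum_of_kappa_ne_top e hq hidq hx0 h.finite_cond
    refine ⟨hx0, hx, h.smooth, le_antisymm ?_ ?_, (sglp_chartMap_iff e hx0).1 h.sglp⟩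
    · have h1 := h.smooth.2
      have h2 := trdeg_sigma_le (n := n) e
      rw [← h1] at h2
      exact_mod_cast h2
    · exact le_finrank_zariskiTangent e hx
  · rintro ⟨hx0, hx, hs, hT, hg⟩
    exact ⟨chartMap_mem_segreTuples e hx0, hs, isIdentifiable_chartSum e hq hidq hx0 hx hT,
      kappa_chartMap_ne_top e hx0 hx, (sglp_chartMap_iff e hx0).2 hg, hx0⟩

/-- Being nice is an open condition. The dimension of the Zariski tangent space can only drop
nearby, but the addition map remains an immersion, so it stays equal to `m`. -/
theorem isOpen_isNice (hid : GenericallyIdentifiable n r) :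
    IsOpen {x : EuclideanSpace ℝ (Fin m) | IsNice n r (chartMap e x)} := by
  rw [isOpen_iff_mem_nhds]
  intro x hx
  obtain ⟨hx0, hxi, hs, hT, hg⟩ := (isNice_chartMap_iff e hid).1 hx
  have h1 : ∀ᶠ y in 𝓝 x, Function.Injective (fderiv ℝ (chartSum e) y) :=
    ((contDiff_chartSum e).continuous_fderiv (by simp)).continuousAt.eventually
      (ContinuousLinearMap.isOpen_injective.mem_nhds hxi)
  have h2 := (contDiff_chartSum e).continuous.continuousAt.eventually
    (eventually_finrank_zariskiTangent_le (vanIdeal (sigma n r)) (chartSum e x))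
  have h3 := (contDiff_chartFactors e).continuous.continuousAt.eventually
    (isOpen_factorsSGLP.mem_nhds hg)
  filter_upwards [(isOpen_corner e).mem_nhds hx0, h1, h2, h3] with y hy0 hyi hyT hyg
  have hyT' : Module.finrank ℝ (zariskiTangent (vanIdeal (sigma n r)) (chartSum e y)) = m := by
    exact le_antisymm (hyT.trans hT.le) (le_finrank_zariskiTangent e hyi)
  refine (isNice_chartMap_iff e hid).2 ⟨hy0, hyi,
    ⟨subset_zariskiClosure _ (chartSum_mem_sigma e y), ?_⟩, hyT', hyg⟩
  rw [hyT', ← hs.2, hT]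

end CPD

/-! ### The symmetric group action on the nice decompositions -/

namespace CPD

variable {d : ℕ} {n : Fin d → ℕ} {r m : ℕ}

lemma smul_mem_segre (k₀ : Fin d) {A : Tensor n} (hA : A ∈ segre n) {c : ℝ} (hc : c ≠ 0) :
    c • A ∈ segre n := by
  obtain ⟨hA0, f, rfl⟩ := hA
  refine ⟨smul_ne_zero hc hA0, fun k j => (if k = k₀ then c else 1) * f k j, ?_⟩
  ext idx
  change c * ∏ k, f k (idx k) = ∏ k, (if k = k₀ then c else 1) * f k (idx k)
  rw [Finset.prod_mul_distrib]
  simp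

/-- An identifiable decomposition is not fixed by any nontrivial permutation: if two of its terms
were equal to `A`, they could be replaced by `(1 + t) A` and `(1 - t) A` for infinitely many `t`. -/
lemma eq_one_of_permTuple_eq (k₀ : Fin d) {a : Tuple n r} (ha : a ∈ segreTuples n r)
    (hid : IsIdentifiable r (addMap a)) {π : Equiv.Perm (Fin r)} (hπ : permTuple π a = a) :
    π = 1 := by
  by_contra hne
  obtain ⟨i, hi⟩ : ∃ i, π⁻¹ i ≠ i := by
    by_contra! h
    exact hne (inv_eq_one.1 (Equiv.ext h))
  set j := π⁻¹ i with hj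
  have hij : a j = a i := congrFun (congrArg WithLp.ofLp hπ) i
  let b : ℝ → Tuple n r := fun t => WithLp.toLp 2 fun l =>
    a l + ((if l = i then t • a i else 0) - if l = j then t • a i else 0)
  have hb : ∀ t ∈ Ioo (0 : ℝ) 1, b t ∈ segreTuples n r := by
    intro t ht l
    by_cases hl : l = i
    · subst hl
      have : b t l = (1 + t) • a l := by simp [b, hi.symm, add_smul]
      rw [this]
      exact smul_mem_segre k₀ (ha l) (by linarith [ht.1])
    · by_cases hl' : l = j
      · have : b t l = (1 - t) • a i := by
          simp only [b, hl', hi, hij, if_true, if_false]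
          module
        rw [this]
        exact smul_mem_segre k₀ (ha i) (by linarith [ht.2])
      · have : b t l = a l := by simp [b, hl, hl']
        rw [this]
        exact ha l
  have hsum : ∀ t, addMap (b t) = addMap a := by
    intro t
    simp [addMap, b, Finset.sum_add_distrib]
  have hmaps : MapsTo (fun t : ℝ => (1 + t) • a i) (Ioo (0 : ℝ) 1) (range fun l => a l) := by
    intro t ht
    obtain ⟨ρ, hρ⟩ := hid.2 a ha (b t) (hb t ht) rfl (hsum t)
    refine ⟨ρ⁻¹ i, ?_⟩
    have h1 : a (ρ⁻¹ i) = b t i := congrFun (congrArg WithLp.ofLp hρ) i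
    change a (ρ⁻¹ i) = (1 + t) • a i
    rw [h1]
    simp [b, hi.symm, add_smul]
  refine (infinite_of_injOn_mapsTo ?_ hmaps (Ioo_infinite one_pos)) (finite_range _)
  intro s _ t _ hst
  have := smul_left_injective ℝ (ha i).1 hst
  linarith

section

variable [∀ k, NeZero (n k)] {k₀ : Fin d} (e : Fin r × ChartIndex n k₀ ≃ Fin m)
  (hid : GenericallyIdentifiable n r)

/-- The open set of the coordinates of the nice decompositions. -/
def niceCoords : TopologicalSpace.Opens (EuclideanSpace ℝ (Fin m)) :=
  ⟨{x | IsNice n r (chartMap e x)}, isOpen_isNice e hid⟩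

lemma corner_ne_zero (x : niceCoords e hid) (i : Fin r) : chartMap e x.1 i 0 ≠ 0 :=
  IsNice.corner (show IsNice n r (chartMap e x.1) from x.2) i

/-- The global chart of the set of nice decompositions. -/
noncomputable def niceHomeomorph : niceCoords e hid ≃ₜ niceTuples n r where
  toFun x := ⟨chartMap e x.1, x.2⟩
  invFun a := ⟨chartInv e a.1, by
    change IsNice n r (chartMap e (chartInv e a.1))
    rw [chartMap_chartInv e a.2.mem_segre a.2.corner]
    exact a.2⟩
  left_inv x := Subtype.ext (chartInv_chartMap e (corner_ne_zero e hid x))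
  right_inv a := Subtype.ext (chartMap_chartInv e a.2.mem_segre a.2.corner)
  continuous_toFun :=
    ((contDiff_chartMap e).continuous.comp continuous_subtype_val).subtype_mk _
  continuous_invFun := by
    refine Continuous.subtype_mk (continuous_iff_continuousAt.2 fun a => ?_) _
    exact ((contDiffAt_chartInv e a.2.corner).continuousAt).comp continuous_subtype_val.continuousAt

@[simp] lemma niceHomeomorph_apply (x : niceCoords e hid) :
    (niceHomeomorph e hid x).1 = chartMap e x.1 := rfl

lemma proj_eq_proj_iff {a b : niceTuples n r} :
    proj a = proj b ↔ ∃ π : Equiv.Perm (Fin r), π • a = b := by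
  rw [proj, proj, Quotient.eq, MulAction.orbitRel_apply, MulAction.mem_orbit_iff]
  exact ⟨fun ⟨π, h⟩ => ⟨π⁻¹, by rw [← h, inv_smul_smul]⟩,
    fun ⟨π, h⟩ => ⟨π⁻¹, by rw [← h, inv_smul_smul]⟩⟩

lemma niceAdd_smul (π : Equiv.Perm (Fin r)) (a : niceTuples n r) :
    niceAdd (π • a) = niceAdd a := Subtype.ext (addMap_permTuple π a.1)

lemma niceAdd_eq_niceAdd_iff {a b : niceTuples n r} :
    niceAdd a = niceAdd b ↔ ∃ π : Equiv.Perm (Fin r), π • a = b := by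
  constructor
  · intro h
    obtain ⟨π, hπ⟩ := a.2.identifiable.2 a.1 a.2.mem_segre b.1 b.2.mem_segre rfl
      (congrArg Subtype.val h.symm)
    exact ⟨π, Subtype.ext hπ⟩
  · rintro ⟨π, rfl⟩
    exact (niceAdd_smul π a).symm

instance : ContinuousConstSMul (Equiv.Perm (Fin r)) (niceTuples n r) :=
  ⟨fun π => ((isometry_permTuple π).continuous.comp continuous_subtype_val).subtype_mk _⟩

lemma continuous_niceAdd : Continuous (niceAdd : niceTuples n r → niceTensors n r) :=
  (continuous_addMap.comp continuous_subtype_val).subtype_mk _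

lemma surjective_niceAdd : Function.Surjective (niceAdd : niceTuples n r → niceTensors n r) := by
  rintro ⟨_, a, ha, rfl⟩
  exact ⟨⟨a, ha⟩, rfl⟩

lemma surjective_proj : Function.Surjective (proj : niceTuples n r → NiceCPD n r) :=
  Quotient.mk_surjective

lemma continuous_proj : Continuous (proj : niceTuples n r → NiceCPD n r) :=
  continuous_quotient_mk'

lemma isOpenMap_proj : IsOpenMap (proj : niceTuples n r → NiceCPD n r) :=
  isOpenMap_quotient_mk'_mul

include e hid

/-- The sums of the nice decompositions near a given one fill a neighbourhood of its sum in the set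
of nice tensors. -/
lemma isOpenMap_niceAdd : IsOpenMap (niceAdd : niceTuples n r → niceTensors n r) := by
  rw [isOpenMap_iff_nhds_le]
  intro a W hW
  obtain ⟨x, rfl⟩ := (niceHomeomorph e hid).surjective a
  obtain ⟨hx0, hxi, -, hT, -⟩ := (isNice_chartMap_iff e hid).1
    (show IsNice n r (chartMap e x.1) from x.2)
  have h1 : niceHomeomorph e hid ⁻¹' (niceAdd ⁻¹' W) ∈ 𝓝 x :=
    (niceHomeomorph e hid).continuous.continuousAt hW
  obtain ⟨U, hU, hUW⟩ := mem_nhds_subtype _ _ _ |>.1 h1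
  have hU' : U ∩ (niceCoords e hid : Set _) ∈ 𝓝 x.1 :=
    inter_mem hU ((niceCoords e hid).isOpen.mem_nhds x.2)
  have h2 := eventually_mem_image_of_immersion (contDiff_chartSum e) (eval_chartSum_eq_zero e) hxi
    (by rw [hT]; simp) hU'
  have h3 : ∀ᶠ B : niceTensors n r in 𝓝 (niceAdd (niceHomeomorph e hid x)),
      (∀ p ∈ vanIdeal (sigma n r), MvPolynomial.eval B.1.ofLp p = 0) →
        B.1 ∈ chartSum e '' (U ∩ (niceCoords e hid : Set _)) :=
    (continuous_subtype_val.tendsto (niceAdd (niceHomeomorph e hid x))).eventually h2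
  filter_upwards [h3] with B hB
  have hBσ : B.1 ∈ sigma n r := by
    obtain ⟨_, a, ha, rfl⟩ := B
    obtain ⟨b, rfl⟩ := exists_elementaryTuple ha.mem_segre
    exact addMap_elementaryTuple_mem_sigma b
  obtain ⟨y, ⟨hyU, hy⟩, hyB⟩ := hB fun p hp => mem_vanIdeal.1 hp _ hBσ
  have h4 : niceAdd (niceHomeomorph e hid ⟨y, hy⟩) = B := Subtype.ext hyB
  rw [← h4]
  exact hUW (show (⟨y, hy⟩ : niceCoords e hid) ∈ Subtype.val ⁻¹' U from hyU)

/-- The addition map is immersive at nice decompositions, hence locally injective. -/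
lemma exists_injOn_niceAdd (a : niceTuples n r) :
    ∃ U : Set (niceTuples n r), IsOpen U ∧ a ∈ U ∧ InjOn niceAdd U := by
  obtain ⟨x, rfl⟩ := (niceHomeomorph e hid).surjective a
  obtain ⟨-, hxi, -⟩ := (isNice_chartMap_iff e hid).1
    (show IsNice n r (chartMap e x.1) from x.2)
  obtain ⟨K, -, U, hU, hUK⟩ :=
    eventually_norm_sub_le_of_injective (hasStrictFDerivAt_chartSum e x.1) hxi
  obtain ⟨V, hVU, hVo, hxV⟩ := mem_nhds_iff.1 hU
  refine ⟨(niceHomeomorph e hid).symm ⁻¹' (Subtype.val ⁻¹' V),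
    (hVo.preimage continuous_subtype_val).preimage (niceHomeomorph e hid).symm.continuous,
    by simpa using hxV, ?_⟩
  intro b hb c hc hbc
  obtain ⟨y, rfl⟩ := (niceHomeomorph e hid).surjective b
  obtain ⟨z, rfl⟩ := (niceHomeomorph e hid).surjective c
  simp only [mem_preimage, Homeomorph.symm_apply_apply] at hb hc
  have h1 := hUK y.1 (hVU hb) z.1 (hVU hc)
  have h2 : chartSum e y.1 = chartSum e z.1 := congrArg Subtype.val hbc
  rw [h2, sub_self, norm_zero, mul_zero, norm_le_zero_iff, sub_eq_zero] at h1
  rw [Subtype.ext h1]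

lemma exists_injOn_proj (a : niceTuples n r) :
    ∃ U : Set (niceTuples n r), IsOpen U ∧ a ∈ U ∧ InjOn proj U := by
  obtain ⟨U, hU, haU, hinj⟩ := exists_injOn_niceAdd e hid a
  refine ⟨U, hU, haU, fun b hb c hc hbc => hinj hb hc ?_⟩
  exact niceAdd_eq_niceAdd_iff.2 (proj_eq_proj_iff.1 hbc)

omit [∀ k, NeZero (n k)] e hid in
lemma isLocalHomeomorph_of_isOpenMap {M X : Type*} [TopologicalSpace M] [TopologicalSpace X]
    {p : M → X} (hc : Continuous p) (ho : IsOpenMap p)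
    (hi : ∀ a, ∃ U : Set M, IsOpen U ∧ a ∈ U ∧ InjOn p U) : IsLocalHomeomorph p := by
  rw [isLocalHomeomorph_iff_isOpenEmbedding_restrict]
  intro a
  obtain ⟨U, hU, haU, hinj⟩ := hi a
  exact ⟨U, hU.mem_nhds haU, .of_continuous_injective_isOpenMap (hc.comp continuous_subtype_val)
    (injOn_iff_injective.1 hinj) (ho.domRestrict hU)⟩

lemma isLocalHomeomorph_niceAdd :
    IsLocalHomeomorph (niceAdd : niceTuples n r → niceTensors n r) :=
  isLocalHomeomorph_of_isOpenMap continuous_niceAdd (isOpenMap_niceAdd e hid)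
    (exists_injOn_niceAdd e hid)

lemma isLocalHomeomorph_proj :
    IsLocalHomeomorph (proj : niceTuples n r → NiceCPD n r) :=
  isLocalHomeomorph_of_isOpenMap continuous_proj isOpenMap_proj (exists_injOn_proj e hid)

/-- The symmetric group acts freely on the nice decompositions, so that the projection to the
quotient is a covering. -/
lemma isCoveringMap_proj : IsCoveringMap (proj : niceTuples n r → NiceCPD n r) := by
  have h : IsQuotientCoveringMap (proj : niceTuples n r → NiceCPD n r) (Equiv.Perm (Fin r)) :=
    { toIsQuotientMap := isQuotientMap_quotient_mk'
      apply_eq_iff_mem_orbit := Quotient.eq''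
      disjoint := by
        intro a
        obtain ⟨U, hU, haU, hinj⟩ := exists_injOn_proj e hid a
        refine ⟨U, hU.mem_nhds haU, ?_⟩
        rintro π ⟨_, ⟨b, hb, rfl⟩, hπb⟩
        have h1 : π • b = b := hinj hπb hb (proj_eq_proj_iff.2 ⟨π⁻¹, inv_smul_smul π b⟩)
        exact eq_one_of_permTuple_eq k₀ b.2.mem_segre b.2.identifiable
          (congrArg Subtype.val h1) }
  exact h.isCoveringMap

omit e hid in
/-- The quotient maps continuously and, by identifiability, injectively to the space of tensors. -/
lemma t2Space_niceCPD : T2Space (NiceCPD n r) := by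
  let q : NiceCPD n r → Tensor n := Quotient.lift (fun a => (niceAdd a).1) (by
    intro a b hab
    exact congrArg Subtype.val (niceAdd_eq_niceAdd_iff.2 (proj_eq_proj_iff.1 (Quotient.sound hab))))
  have hq : Continuous q := (continuous_subtype_val.comp continuous_niceAdd).quotient_lift _
  refine T2Space.of_injective_continuous (f := q) ?_ hq
  intro y z hyz
  obtain ⟨a, rfl⟩ := surjective_proj y
  obtain ⟨b, rfl⟩ := surjective_proj z
  exact proj_eq_proj_iff.2 (niceAdd_eq_niceAdd_iff.1 (Subtype.ext hyz))

end

end CPD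

/-! ### Metrics on quotients and condition numbers -/

section OpenSubset

variable {m : ℕ}

/-- The differential of the inclusion of an open subset of a Euclidean space is bijective. -/
lemma bijective_mfderiv_subtypeVal (Ω : TopologicalSpace.Opens (EuclideanSpace ℝ (Fin m))) (x : Ω) :
    Function.Bijective (mfderiv (𝓡 m) (𝓡 m) (Subtype.val : Ω → EuclideanSpace ℝ (Fin m)) x) := by
  classical
  -- A local section of the inclusion; its values outside `Ω` are irrelevant.
  let s : EuclideanSpace ℝ (Fin m) → Ω := fun y => if hy : y ∈ Ω then ⟨y, hy⟩ else x
  have hsx : s x.1 = x := by simp [s]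
  have hs : Subtype.val ∘ s =ᶠ[𝓝 x.1] id := by
    filter_upwards [Ω.isOpen.mem_nhds x.2] with y hy
    have : y ∈ Ω := hy
    simp [s, this]
  have h1 : ContMDiffAt (𝓡 m) (𝓡 m) ∞ s x.1 :=
    (ContMDiffAt.subtypeVal_comp_iff Ω s x.1).1 (contMDiffAt_id.congr_of_eventuallyEq hs)
  have h2 : MDifferentiableAt (𝓡 m) (𝓡 m) (Subtype.val : Ω → EuclideanSpace ℝ (Fin m))
      (s x.1) := (contMDiff_subtype_val (n := ∞)).mdifferentiable (by simp) _
  have h3 := hs.mfderiv_eq (I := 𝓡 m) (I' := 𝓡 m)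
  rw [mfderiv_comp x.1 h2 (h1.mdifferentiableAt (by simp)), mfderiv_id, hsx] at h3
  let D : EuclideanSpace ℝ (Fin m) →ₗ[ℝ] EuclideanSpace ℝ (Fin m) :=
    (mfderiv (𝓡 m) (𝓡 m) (Subtype.val : Ω → EuclideanSpace ℝ (Fin m)) x).toLinearMap
  have hD : Function.Surjective D := fun v => ⟨_, DFunLike.congr_fun h3 v⟩
  have hD' : Function.Injective D := LinearMap.injective_iff_surjective.2 hD
  exact ⟨hD', hD⟩

end OpenSubset

section QuotientMetric

variable {m : ℕ} {M N X : Type}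
  [TopologicalSpace M] [ChartedSpace (EuclideanSpace ℝ (Fin m)) M]
  [TopologicalSpace N] [ChartedSpace (EuclideanSpace ℝ (Fin m)) N]
  [TopologicalSpace X] [ChartedSpace (EuclideanSpace ℝ (Fin m)) X]
  {F : Type} [NormedAddCommGroup F] [InnerProductSpace ℝ F]

lemma IsLocalDiffeomorph.bijective_mfderiv {p : M → X}
    (hp : IsLocalDiffeomorph (𝓡 m) (𝓡 m) ∞ p) (x : M) :
    Function.Bijective (mfderiv (𝓡 m) (𝓡 m) p x) :=
  (hp.mfderivToContinuousLinearEquiv (by simp) x).bijective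

/-- Two lifts of the same map through the quotient by a group action agree up to a constant
group element near each point, if the quotient map is locally injective. -/
lemma exists_eventuallyEq_smul {G T : Type*} [SMul G M] [ContinuousConstSMul G M]
    [TopologicalSpace T] {p : M → X} (hp : IsLocalHomeomorph p)
    (hG : ∀ a b : M, p a = p b ↔ ∃ σ : G, σ • a = b) {f f' : T → M} {t : T}
    (hf : ContinuousAt f t) (hf' : ContinuousAt f' t) (h : p ∘ f =ᶠ[𝓝 t] p ∘ f') :
    ∃ σ : G, f =ᶠ[𝓝 t] fun u => σ • f' u := by
  obtain ⟨σ, hσ⟩ := (hG (f' t) (f t)).1 h.self_of_nhds.symm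
  refine ⟨σ, ?_⟩
  obtain ⟨e, het, rfl⟩ := hp (f t)
  have h1 : ∀ᶠ u in 𝓝 t, f u ∈ e.source := hf (e.open_source.mem_nhds het)
  have h2 : ∀ᶠ u in 𝓝 t, σ • f' u ∈ e.source :=
    (hf'.const_smul σ) (e.open_source.mem_nhds (show σ • f' t ∈ e.source by rwa [hσ]))
  filter_upwards [h, h1, h2] with u hu hu1 hu2
  exact e.injOn hu1 hu2 (hu.trans ((hG _ _).2 ⟨σ, rfl⟩))

/-- The quotient of a submanifold of a Euclidean space by a group that acts by restrictions of
linear isometries carries a metric for which the quotient map is a local isometry. It is the one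
that is induced by the local inverses of the quotient map. -/
theorem exists_isLocalIsometry_quotient [IsManifold (𝓡 m) ∞ M] [IsManifold (𝓡 m) ∞ X]
    {G : Type*} [SMul G M] [ContinuousConstSMul G M]
    {p : M → X} (hp : IsLocalDiffeomorph (𝓡 m) (𝓡 m) ∞ p) (hs : Function.Surjective p)
    (hG : ∀ a b : M, p a = p b ↔ ∃ σ : G, σ • a = b) {g : RMetric m M} {ι : M → F}
    (hι : g.IsInherited ι) (L : G → F →ₗᵢ[ℝ] F) (hL : ∀ σ a, ι (σ • a) = L σ (ι a)) :
    ∃ ghat : RMetric m X, RMetric.IsLocalIsometry g ghat p := by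
  choose a ha using hs
  let s : X → X → M := fun y => (hp (a y)).localInverse
  have hsc : ∀ y, ContMDiffAt (𝓡 m) (𝓡 m) ∞ (s y) y := fun y => by
    have := (hp (a y)).localInverse_contMDiffAt
    rwa [ha] at this
  have hso : ∀ y, ∀ᶠ z in 𝓝 y, ContinuousAt (s y) z := fun y => by
    have h1 := (hp (a y)).localInverse_open_source.mem_nhds (hp (a y)).localInverse_mem_source
    rw [ha] at h1
    filter_upwards [h1] with z hz
    exact (hp (a y)).localInverse_contMDiffOn.continuousOn.continuousAt
      ((hp (a y)).localInverse_open_source.mem_nhds hz)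
  have hsr : ∀ y, p ∘ s y =ᶠ[𝓝 y] id := fun y => by
    have := (hp (a y)).localInverse_eventuallyEq_right
    rwa [ha] at this
  have hιinj : ∀ b, Function.Injective (mfderiv (𝓡 m) 𝓘(ℝ, F) ι b) := by
    intro b
    refine (injective_iff_map_eq_zero _).2 fun v hv => by_contra fun hv0 => ?_
    have := g.pos b v hv0
    rw [hι.inner_eq, hv] at this
    exact this.ne' (inner_zero_left _)
  have hdι : ∀ y, mfderiv (𝓡 m) 𝓘(ℝ, F) (ι ∘ s y) y =
      (mfderiv (𝓡 m) 𝓘(ℝ, F) ι (s y y)).comp (mfderiv (𝓡 m) (𝓡 m) (s y) y) := fun y =>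
    mfderiv_comp y (hι.contMDiff.mdifferentiable (by simp) _)
      ((hsc y).mdifferentiableAt (by simp))
  have hds : ∀ y v, mfderiv (𝓡 m) (𝓡 m) p (s y y) (mfderiv (𝓡 m) (𝓡 m) (s y) y v) = v := by
    intro y v
    have h1 := (hsr y).mfderiv_eq (I := 𝓡 m) (I' := 𝓡 m)
    rw [mfderiv_comp y (hp.contMDiff.mdifferentiable (by simp) _)
      ((hsc y).mdifferentiableAt (by simp)), mfderiv_id] at h1
    exact DFunLike.congr_fun h1 v
  obtain ⟨ghat, hghat⟩ := exists_rMetric_of_immersions (m := m) (fun y => ι ∘ s y)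
    (fun y => hι.contMDiff.contMDiffAt.comp y (hsc y))
    (fun y v w hvw => by
      rw [hdι] at hvw
      have h1 := hιinj _ hvw
      exact (hds y v).symm.trans ((congrArg _ h1).trans (hds y w)))
    (fun y => by
      filter_upwards [hso y, (hsr y).eventually_nhds] with z hz1 hz2
      obtain ⟨σ, hσ⟩ := exists_eventuallyEq_smul (G := G) hp.isLocalHomeomorph hG hz1
        (hsc z).continuousAt (EventuallyEq.trans hz2 (hsr z).symm)
      refine ⟨L σ, ?_⟩
      filter_upwards [hσ] with u hu
      simp only [Function.comp_apply, hu, hL])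
  refine ⟨ghat, hp, fun b v w => ?_⟩
  have hpb : ContinuousAt p b := hp.contMDiff.continuous.continuousAt
  obtain ⟨σ, hσ⟩ := exists_eventuallyEq_smul (G := G) hp.isLocalHomeomorph hG
    ((hsc (p b)).continuousAt.comp hpb) continuousAt_id
    (hpb.eventually (hsr (p b)))
  have h1 : HasMFDerivAt (𝓡 m) 𝓘(ℝ, F) ((ι ∘ s (p b)) ∘ p) b
      ((L σ).toContinuousLinearMap ∘L mfderiv (𝓡 m) 𝓘(ℝ, F) ι b) := by
    refine ((L σ).toContinuousLinearMap.hasMFDerivAt.comp b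
      (hι.contMDiff.mdifferentiable (by simp) b).hasMFDerivAt).congr_of_eventuallyEq ?_
    filter_upwards [hσ] with u hu
    change ι ((s (p b) ∘ p) u) = L σ (ι u)
    rw [hu, hL, id]
  have h2 := h1.mfderiv
  rw [mfderiv_comp b ((hι.contMDiff.contMDiffAt.comp (p b) (hsc (p b))).mdifferentiableAt (by simp))
    (hp.contMDiff.mdifferentiable (by simp) _)] at h2
  rw [hghat, hι.inner_eq]
  have h3 := fun v => DFunLike.congr_fun h2 v
  exact (congrArg₂ (fun v w : F => inner ℝ v w) (h3 v) (h3 w)).trans ((L σ).inner_map_map _ _)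

/-- A surjective local isometry determines the metric of its target. -/
lemma RMetric.IsLocalIsometry.eq_of_surjective [IsManifold (𝓡 m) ∞ M] [IsManifold (𝓡 m) ∞ X]
    {p : M → X} {g : RMetric m M} {h h' : RMetric m X} (hp : RMetric.IsLocalIsometry g h p)
    (hp' : RMetric.IsLocalIsometry g h' p) (hs : Function.Surjective p) : h = h' := by
  have : h.inner = h'.inner := by
    funext x
    obtain ⟨a, rfl⟩ := hs x
    ext v w
    obtain ⟨v, rfl⟩ := (hp.isLocalDiffeomorph.bijective_mfderiv a).2 v
    obtain ⟨w, rfl⟩ := (hp.isLocalDiffeomorph.bijective_mfderiv a).2 w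
    rw [hp.inner_eq, hp'.inner_eq]
  cases h
  cases h'
  congr

/-- The condition number of a map `τ` such that `τ ∘ q` is a local isometry, for a local
diffeomorphism `q`, is governed by the differential of `q`. -/
lemma RMetric.conditionNumber_eq_iSup [IsManifold (𝓡 m) ∞ M] [IsManifold (𝓡 m) ∞ N]
    [IsManifold (𝓡 m) ∞ X] {g : RMetric m M} {h : RMetric m N} {k : RMetric m X} {q : M → N}
    {τ : N → X} (hq : IsLocalDiffeomorph (𝓡 m) (𝓡 m) ∞ q) (hτ : ContMDiff (𝓡 m) (𝓡 m) ∞ τ)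
    (hp : RMetric.IsLocalIsometry g k (τ ∘ q)) (a : M) :
    RMetric.conditionNumber h k τ (q a) = ⨆ (v : TangentSpace (𝓡 m) a) (_ : v ≠ 0),
      ENNReal.ofReal (g.tnorm a v / h.tnorm (q a) (mfderiv (𝓡 m) (𝓡 m) q a v)) := by
  unfold RMetric.conditionNumber
  rw [← (hq.bijective_mfderiv a).2.iSup_comp]
  refine iSup_congr fun v => iSup_congr_Prop ?_ fun _ => ?_
  · exact (map_ne_zero_iff _ (hq.bijective_mfderiv a).1)
  · rw [← hp.tnorm_mfderiv, mfderiv_comp a (hτ.mdifferentiable (by simp) _)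
      (hq.contMDiff.mdifferentiable (by simp) _)]
    rfl

end QuotientMetric

section Parametrization

variable {m : ℕ} {Ω : TopologicalSpace.Opens (EuclideanSpace ℝ (Fin m))} {X : Type}
  [TopologicalSpace X] [ChartedSpace (EuclideanSpace ℝ (Fin m)) X]
  {F : Type} [NormedAddCommGroup F] [InnerProductSpace ℝ F]

/-- The chain rule for a local parametrization `P` of `X`, in which the map `ι` on `X` is
expressed by the map `f` on a Euclidean space. -/
lemma mfderiv_mfderiv_of_comp_eq {P : Ω → X} (hP : IsLocalDiffeomorph (𝓡 m) (𝓡 m) ∞ P)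
    {ι : X → F} (hι : ContMDiff (𝓡 m) 𝓘(ℝ, F) ∞ ι) {f : EuclideanSpace ℝ (Fin m) → F}
    (hf : Differentiable ℝ f) (h : ι ∘ P = f ∘ Subtype.val) (x : Ω) (w : TangentSpace (𝓡 m) x) :
    mfderiv (𝓡 m) 𝓘(ℝ, F) ι (P x) (mfderiv (𝓡 m) (𝓡 m) P x w) =
      fderiv ℝ f x.1 (mfderiv (𝓡 m) (𝓡 m) (Subtype.val : Ω → EuclideanSpace ℝ (Fin m)) x w) := by
  have h1 := mfderiv_comp x (hι.mdifferentiable (by simp) (P x))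
    (hP.contMDiff.mdifferentiable (by simp) x)
  have h2 := mfderiv_comp x (g := f) (hf x.1).mdifferentiableAt
    ((contMDiff_subtype_val (I := 𝓡 m) (U := Ω) (n := ∞)).mdifferentiable (by simp) x)
  rw [h, h2, mfderiv_eq_fderiv] at h1
  exact (DFunLike.congr_fun h1 w).symm

/-- A submanifold of a Euclidean space that is parametrized by immersions inherits a metric. -/
theorem exists_isInherited [IsManifold (𝓡 m) ∞ X] {P : Ω → X}
    (hP : IsLocalDiffeomorph (𝓡 m) (𝓡 m) ∞ P) (hs : Function.Surjective P)
    {ι : X → F} (hι : Topology.IsEmbedding ι) {f : EuclideanSpace ℝ (Fin m) → F}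
    (hf : ContDiff ℝ ∞ f) (h : ι ∘ P = f ∘ Subtype.val)
    (hinj : ∀ x : Ω, Function.Injective (fderiv ℝ f x.1)) :
    ∃ g : RMetric m X, g.IsInherited ι := by
  have hιs : ContMDiff (𝓡 m) 𝓘(ℝ, F) ∞ ι := by
    refine ContMDiff.of_comp_isLocalDiffeomorph hP hs ?_
    rw [h]
    exact hf.contMDiff.comp contMDiff_subtype_val
  obtain ⟨g, hg⟩ := exists_rMetric_of_immersions (m := m) (X := X) (fun _ => ι)
    (fun x => hιs.contMDiffAt)
    (fun y => by
      obtain ⟨x, rfl⟩ := hs y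
      intro v w hvw
      obtain ⟨v, rfl⟩ := (hP.bijective_mfderiv x).2 v
      obtain ⟨w, rfl⟩ := (hP.bijective_mfderiv x).2 w
      rw [mfderiv_mfderiv_of_comp_eq hP hιs (hf.differentiable (by simp)) h,
        mfderiv_mfderiv_of_comp_eq hP hιs (hf.differentiable (by simp)) h] at hvw
      rw [(bijective_mfderiv_subtypeVal Ω x).1 (hinj x hvw)])
    (fun x₀ => Eventually.of_forall fun x => ⟨LinearIsometry.id, Eventually.of_forall fun _ => rfl⟩)
  exact ⟨g, hιs, hι, hg⟩

lemma RMetric.IsInherited.tnorm_eq [IsManifold (𝓡 m) ∞ X] {g : RMetric m X} {ι : X → F}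
    (hg : g.IsInherited ι) (x : X) (v : TangentSpace (𝓡 m) x) :
    g.tnorm x v = @norm F _ (mfderiv (𝓡 m) 𝓘(ℝ, F) ι x v) := by
  unfold RMetric.tnorm
  rw [hg.inner_eq]
  exact (norm_eq_sqrt_real_inner (F := F) _).symm

end Parametrization

/-! ### The tensor decomposition map -/

namespace CPD

variable {d : ℕ} {n : Fin d → ℕ} {r m : ℕ} [∀ k, NeZero (n k)] {k₀ : Fin d}
  (e : Fin r × ChartIndex n k₀ ≃ Fin m) (hid : GenericallyIdentifiable n r)

/-- The permutations act on the nice decompositions by smooth maps in the chart. -/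
lemma contMDiff_niceHomeomorph_smul (π : Equiv.Perm (Fin r)) :
    ContMDiff (𝓡 m) (𝓡 m) ∞
      (fun x => (niceHomeomorph e hid).symm (π • niceHomeomorph e hid x)) := by
  rw [← ContMDiff.subtypeVal_comp_iff]
  intro x
  have h1 : ContMDiffAt (𝓡 m) (𝓡 m) ∞ (fun y => chartInv e (permTuple π (chartMap e y))) x.1 := by
    rw [contMDiffAt_iff_contDiffAt]
    have h2 : ContDiff ℝ ω (fun y => permTuple π (chartMap e y)) :=
      (contDiff_permTuple π).comp (contDiff_chartMap e)
    exact ((contDiffAt_chartInv e fun i => corner_ne_zero e hid x (π⁻¹ i)).comp x.1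
      h2.contDiffAt).of_le le_top
  exact contMDiffAt_subtype_iff.2 h1

/-- The condition number, computed in the chart, is the condition number of the decomposition
map. -/
lemma kappa_niceHomeomorph [ChartedSpace (EuclideanSpace ℝ (Fin m)) (niceTuples n r)]
    [IsManifold (𝓡 m) ∞ (niceTuples n r)]
    [ChartedSpace (EuclideanSpace ℝ (Fin m)) (niceTensors n r)]
    [IsManifold (𝓡 m) ∞ (niceTensors n r)]
    (hφ : IsLocalDiffeomorph (𝓡 m) (𝓡 m) ∞ (niceHomeomorph e hid))
    (hadd : IsLocalDiffeomorph (𝓡 m) (𝓡 m) ∞ (niceAdd : niceTuples n r → niceTensors n r))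
    {g : RMetric m (niceTuples n r)} {h : RMetric m (niceTensors n r)}
    (hg : g.IsInherited (Subtype.val : niceTuples n r → Tuple n r))
    (hh : h.IsInherited (Subtype.val : niceTensors n r → Tensor n)) (x : niceCoords e hid) :
    kappa (niceHomeomorph e hid x).1 =
      ⨆ (v : TangentSpace (𝓡 m) (niceHomeomorph e hid x)) (_ : v ≠ 0),
        ENNReal.ofReal (g.tnorm _ v /
          h.tnorm _ (mfderiv (𝓡 m) (𝓡 m) niceAdd (niceHomeomorph e hid x) v)) := by
  obtain ⟨q, hq, hidq⟩ := hid.exists_polynomial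
  obtain ⟨hx0, hxi, -⟩ := (isNice_chartMap_iff e hid).1
    (show IsNice n r (chartMap e x.1) from x.2)
  rw [niceHomeomorph_apply, kappa_chartMap e hq hidq hx0 hxi]
  rw [← (hφ.bijective_mfderiv x).2.iSup_comp]
  have hval : Function.Surjective fun w : TangentSpace (𝓡 m) x =>
      (mfderiv (𝓡 m) (𝓡 m) (Subtype.val : niceCoords e hid → EuclideanSpace ℝ (Fin m)) x w :
        EuclideanSpace ℝ (Fin m)) := (bijective_mfderiv_subtypeVal _ x).2
  refine (hval.iSup_comp fun v => ⨆ (_ : v ≠ 0),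
    ENNReal.ofReal (‖fderiv ℝ (chartMap e) x.1 v‖ / ‖fderiv ℝ (chartSum e) x.1 v‖)).symm.trans ?_
  refine iSup_congr fun w => iSup_congr_Prop ?_ fun _ => ?_
  · exact (map_ne_zero_iff _ (bijective_mfderiv_subtypeVal _ x).1).trans
      (map_ne_zero_iff _ (hφ.bijective_mfderiv x).1).symm
  · rw [hg.tnorm_eq, hh.tnorm_eq]
    have h1 := mfderiv_mfderiv_of_comp_eq hφ hg.contMDiff
      ((contDiff_chartMap e).differentiable (by simp)) rfl x w
    have h2 := mfderiv_mfderiv_of_comp_eq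
      (P := fun y => niceAdd (niceHomeomorph e hid y))
      (fun y => (hφ y).comp (𝓡 m) _ (hadd _)) hh.contMDiff
      ((contDiff_chartSum e).differentiable (by simp)) rfl x w
    have h3 := mfderiv_comp x (hadd.contMDiff.mdifferentiable (by simp) (niceHomeomorph e hid x))
      (hφ.contMDiff.mdifferentiable (by simp) x)
    have h4 : mfderiv (𝓡 m) (𝓡 m) (fun y => niceAdd (niceHomeomorph e hid y)) x w =
        mfderiv (𝓡 m) (𝓡 m) niceAdd (niceHomeomorph e hid x)
          (mfderiv (𝓡 m) (𝓡 m) (niceHomeomorph e hid) x w) := DFunLike.congr_fun h3 w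
    rw [h4] at h2
    exact congrArg ENNReal.ofReal (congrArg₂ (fun (a : Tuple n r) (b : Tensor n) => ‖a‖ / ‖b‖)
      h1.symm h2.symm)

end CPD

theorem lemma4p5 {d : ℕ} (hd : 0 < d) (n : Fin d → ℕ) [∀ k, NeZero (n k)] (r m : ℕ)
    (hm : m = r * (1 + ∑ k, (n k - 1)))
    (hid : CPD.GenericallyIdentifiable n r) :
    -- the smooth structures on `M`, `N` and `M̂`
    ∃ (_ : ChartedSpace (EuclideanSpace ℝ (Fin m)) (CPD.niceTuples n r))
      (_ : IsManifold (𝓡 m) ∞ (CPD.niceTuples n r))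
      (_ : ChartedSpace (EuclideanSpace ℝ (Fin m)) (CPD.niceTensors n r))
      (_ : IsManifold (𝓡 m) ∞ (CPD.niceTensors n r))
      (_ : ChartedSpace (EuclideanSpace ℝ (Fin m)) (CPD.NiceCPD n r))
      (_ : IsManifold (𝓡 m) ∞ (CPD.NiceCPD n r))
      -- the inherited metrics on `M` and `N`
      (g : RMetric m (CPD.niceTuples n r)) (h : RMetric m (CPD.niceTensors n r)),
      g.IsInherited (Subtype.val : CPD.niceTuples n r → CPD.Tuple n r) ∧
      h.IsInherited (Subtype.val : CPD.niceTensors n r → CPD.Tensor n) ∧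
      T2Space (CPD.NiceCPD n r) ∧ SecondCountableTopology (CPD.NiceCPD n r) ∧
      ContMDiff (𝓡 m) (𝓡 m) ∞ (CPD.decompositionMap : CPD.niceTensors n r → CPD.NiceCPD n r) ∧
      -- the metric on `M̂`
      ∃ ghat : RMetric m (CPD.NiceCPD n r),
        RMetric.IsLocalIsometry g ghat CPD.proj ∧
        (∀ g' : RMetric m (CPD.NiceCPD n r),
          RMetric.IsLocalIsometry g g' CPD.proj → g' = ghat) ∧
        (∀ a : CPD.niceTuples n r,
          CPD.kappa a.1 =
            RMetric.conditionNumber h ghat CPD.decompositionMap (CPD.niceAdd a)) ∧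
        (∀ a b : CPD.niceTuples n r,
          IsLeast (Set.range fun π : Equiv.Perm (Fin r) => RMetric.dist g a (π • b))
            (RMetric.dist ghat (CPD.proj a) (CPD.proj b))) := by
  open CPD in
  -- The choice of the factor that is not normalized in the chart is immaterial.
  let k₀ : Fin d := ⟨0, hd⟩
  let e : Fin r × ChartIndex n k₀ ≃ Fin m := Fintype.equivOfCardEq (by
    rw [Fintype.card_prod, card_chartIndex, Fintype.card_fin, Fintype.card_fin, hm])
  let φ := niceHomeomorph e hid
  obtain ⟨csM, manM, hφ⟩ := exists_chartedSpace_isLocalDiffeomorph (m := m) (p := φ)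
    φ.isLocalHomeomorph φ.surjective
    (fun x y hxy => ⟨id, contMDiff_id, φ.injective hxy, fun _ => rfl⟩)
  have hperm : ∀ π : Equiv.Perm (Fin r),
      ContMDiff (𝓡 m) (𝓡 m) ∞ (fun a : niceTuples n r => π • a) := fun π => by
    refine ContMDiff.of_comp_isLocalDiffeomorph hφ φ.surjective ?_
    convert hφ.contMDiff.comp (contMDiff_niceHomeomorph_smul e hid π) using 1
    funext x
    exact (φ.apply_symm_apply _).symm
  obtain ⟨csN, manN, hadd⟩ := exists_chartedSpace_isLocalDiffeomorph (m := m)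
    (p := (niceAdd : niceTuples n r → niceTensors n r)) (isLocalHomeomorph_niceAdd e hid)
    surjective_niceAdd fun a b hab => by
      obtain ⟨π, hπ⟩ := niceAdd_eq_niceAdd_iff.1 hab
      exact ⟨_, hperm π, hπ, niceAdd_smul π⟩
  obtain ⟨csQ, manQ, hproj⟩ := exists_chartedSpace_isLocalDiffeomorph (m := m)
    (p := (proj : niceTuples n r → NiceCPD n r)) (isLocalHomeomorph_proj e hid)
    surjective_proj fun a b hab => by
      obtain ⟨π, hπ⟩ := proj_eq_proj_iff.1 hab
      exact ⟨_, hperm π, hπ, fun z => (proj_eq_proj_iff.2 ⟨π, rfl⟩).symm⟩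
  have himm : ∀ x : niceCoords e hid, (∀ i, chartMap e x.1 i 0 ≠ 0) ∧
      Function.Injective (fderiv ℝ (chartSum e) x.1) := fun x =>
    have h := (isNice_chartMap_iff e hid).1 (show IsNice n r (chartMap e x.1) from x.2)
    ⟨h.1, h.2.1⟩
  obtain ⟨g, hg⟩ := exists_isInherited hφ φ.surjective
    (Topology.IsEmbedding.subtypeVal (p := (· ∈ niceTuples n r)))
    ((contDiff_chartMap e).of_le le_top) rfl fun x => injective_fderiv_chartMap e (himm x).1
  obtain ⟨h, hh⟩ := exists_isInherited (P := niceAdd ∘ φ) (fun x => (hφ x).comp (𝓡 m) _ (hadd _))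
    (surjective_niceAdd.comp φ.surjective)
    (Topology.IsEmbedding.subtypeVal (p := (· ∈ niceTensors n r)))
    ((contDiff_chartSum e).of_le le_top) rfl fun x => (himm x).2
  have hcomp : decompositionMap ∘ niceAdd = (proj : niceTuples n r → NiceCPD n r) :=
    funext decompositionMap_niceAdd
  have hτ : ContMDiff (𝓡 m) (𝓡 m) ∞ (decompositionMap : niceTensors n r → NiceCPD n r) :=
    ContMDiff.of_comp_isLocalDiffeomorph hadd surjective_niceAdd (hcomp ▸ hproj.contMDiff)
  obtain ⟨ghat, hghat⟩ := exists_isLocalIsometry_quotient hproj surjective_proj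
    (fun _ _ => proj_eq_proj_iff) hg permLinearIsometry fun _ _ => rfl
  refine ⟨csM, manM, csN, manN, csQ, manQ, g, h, hg, hh, t2Space_niceCPD,
    ContinuousConstSMul.secondCountableTopology, hτ, ghat, hghat,
    fun g' hg' => hg'.eq_of_surjective hghat surjective_proj, fun a => ?_,
    hghat.isLeast_dist (isCoveringMap_proj e hid) fun _ _ => proj_eq_proj_iff⟩
  obtain ⟨x, rfl⟩ := φ.surjective a
  rw [RMetric.conditionNumber_eq_iSup hadd hτ (hcomp ▸ hghat)]
  exact kappa_niceHomeomorph e hid hφ hadd hg hh x
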